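/- **Lemma.** For every $k\in\mathbb N$ there is an MSO transduction that, given a finite simple graph $G$, outputs exactly (up to isomorphism of structures) all sane tree decompositions of $G$ whose family of adhesions can be captured by a $k$-colorable guidance system over $G$. Here the following definitions are used. *Tree decompositions.* A tree decomposition $t$ of $G$ is a finite rooted forest in which every node $x$ carries a set $\beta(x)\subseteq V(G)$, its bag, such that both endpoints of every edge of $G$ lie together in some bag, and for every vertex $v$ the nodes whose bags contain $v$ form a nonempty connected part of the forest. The adhesion $\sigma(x)$ is the intersection of $\beta(x)$ with the bag of the parent of $x$ (and $\sigma(x)=\emptyset$ if $x$ is a root); the margin of $x$ is $\beta(x)\setminus\sigma(x)$; the cone $\gamma(x)$ is the union of the bags of the descendants of $x$, including $x$; the component of $x$ is $\alpha(x)=\gamma(x)\setminus\sigma(x)$. The decomposition is sane if for every node $x$: the margin of $x$ is nonempty; $G[\gamma(x)]$ and $G[\alpha(x)]$ are connected; and every vertex of $\sigma(x)$ has a neighbor in $\alpha(x)$. The family of adhesions is $\{\sigma(x): x \text{ a node of } t\}$. *Guidance systems.* An in-tree in $G$ is a subgraph of $G$ that is a tree with a distinguished root, towards which its edges are directed. A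 guidance system $\Lambda$ over $G$ is a family of in-trees in $G$; for a vertex $u$, $\Lambda(u)$ is the set of roots of those in-trees of $\Lambda$ that contain $u$. $\Lambda$ captures a family $\mathcal X$ of vertex sets if every $X\in\mathcal X$ satisfies $X\subseteq\Lambda(u)$ for some vertex $u$. $\Lambda$ is $k$-colorable if its in-trees can be colored with $k$ colors so that distinct in-trees of the same color are vertex-disjoint. *Representation by structures.* A graph is represented by the structure whose universe consists of its vertices and edges, with the binary relation $\mathsf{incident}(v,e)$. A tree decomposition of $G$ is represented by the structure whose universe consists of the vertices and edges of $G$ and the nodes, with the relation $\mathsf{incident}$ of $G$, the unary relation $\mathsf{node}$ selecting the nodes, $\mathsf{parent}(x,y)$ ($y$ is the parent of $x$) and $\mathsf{bag}(v,x)$ ($v\in\beta(x)$). *MSO transductions.* An MSO transduction is an isomorphism-invariant binary relation between finite structures over two finite relational vocabularies (input and output) that is a finite composition of relations of the following kinds. (1) $n$-copying: the output consists of $n$ disjoint copies of the input, with an additional binary predicate relating the copies of the same element and unary predicates selecting the $n$ layers. (2) $n$-coloring: the outputs are all expansions of the input by $n$ arbitrary unary predicates. (3) Interpretation, given by MSO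 formulas over the input vocabulary: a sentence $\varphi_{\mathsf{dom}}$, a formula $\varphi_{\mathsf{univ}}$ with one free element variable, and for each output relation symbol $R$ a formula $\varphi_R$ with as many free element variables as the arity of $R$; if the input satisfies $\varphi_{\mathsf{dom}}$, the output has as universe the elements satisfying $\varphi_{\mathsf{univ}}$, with each $R$ interpreted by $\varphi_R$; otherwise there is no output. -/

import Mathlib

namespace MSOTransduction

/-! ### Finite relational structures and monadic second-order logic -/

/-- A finite structure over the language `L`. The universe may be empty. -/
structure FinStr (L : FirstOrder.Language.{0, 0}) where
  carrier : Type
  [finite : Finite carrier]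
  [str : L.Structure carrier]

attribute [instance] FinStr.finite FinStr.str

/-- Isomorphism of finite structures. -/
def FinStr.Iso {L : FirstOrder.Language.{0, 0}} (A B : FinStr L) : Prop :=
  Nonempty (L.Equiv A.carrier B.carrier)

/-- Formulas of monadic second-order logic over a relational language `L`, with free element
variables indexed by `Fin n` and free set variables indexed by `Fin m`. As for Mathlib's bounded
formulas, a quantifier binds the last variable of its kind. All other connectives and quantifiers
are definable from the ones below. -/
inductive MSOFormula (L : FirstOrder.Language.{0, 0}) : ℕ → ℕ → Type
  | falsum {n m : ℕ} : MSOFormula L n m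
  | equal {n m : ℕ} (i j : Fin n) : MSOFormula L n m
  | rel {n m l : ℕ} (R : L.Relations l) (v : Fin l → Fin n) : MSOFormula L n m
  | mem {n m : ℕ} (i : Fin n) (X : Fin m) : MSOFormula L n m
  | imp {n m : ℕ} (φ ψ : MSOFormula L n m) : MSOFormula L n m
  | allElem {n m : ℕ} (φ : MSOFormula L (n + 1) m) : MSOFormula L n m
  | allSet {n m : ℕ} (φ : MSOFormula L n (m + 1)) : MSOFormula L n m

/-- Satisfaction of a formula in a structure with universe `M`, under a valuation `x` of the
element variables and a valuation `X` of the set variables. -/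
def MSOFormula.Realize {L : FirstOrder.Language.{0, 0}} {M : Type} [L.Structure M] :
    {n m : ℕ} → MSOFormula L n m → (Fin n → M) → (Fin m → Set M) → Prop
  | _, _, .falsum, _, _ => False
  | _, _, .equal i j, x, _ => x i = x j
  | _, _, .rel R v, x, _ => FirstOrder.Language.Structure.RelMap R fun a => x (v a)
  | _, _, .mem i j, x, X => x i ∈ X j
  | _, _, .imp φ ψ, x, X => φ.Realize x X → ψ.Realize x X
  | _, _, .allElem φ, x, X => ∀ a : M, φ.Realize (Fin.snoc x a) X
  | _, _, .allSet φ, x, X => ∀ Y : Set M, φ.Realize x (Fin.snoc X Y)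

/-! ### Transductions -/

/-- A transduction, as a binary relation between input structures over `L` and output structures
over `L'`: `T A B` means that `B` is an output of `T` on the input `A`. -/
def Transduction (L L' : FirstOrder.Language.{0, 0}) : Type 1 := FinStr L → FinStr L' → Prop

/-- Composition: first `S`, then `T`. -/
def Transduction.comp {L₁ L₂ L₃ : FirstOrder.Language.{0, 0}}
    (S : Transduction L₁ L₂) (T : Transduction L₂ L₃) : Transduction L₁ L₃ :=
  fun A C => ∃ B, S A B ∧ T B C

/-- The predicates added by `k`-copying: the binary predicate `copy` and the unary predicates
`layer i`. -/
inductive CopyRel (k : ℕ) : ℕ → Type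
  | copy : CopyRel k 2
  | layer (i : Fin k) : CopyRel k 1

/-- The vocabulary of the predicates added by `k`-copying. -/
def copyLanguage (k : ℕ) : FirstOrder.Language.{0, 0} := ⟨fun _ => Empty, CopyRel k⟩

/-- The structure consisting of `k` disjoint copies of `A`: a relation of `A` holds between
elements of the output if they lie in the same copy and their originals are related in `A`;
`copy` relates the copies of the same element, and `layer i` selects the `i`-th copy. -/
def copyStr {L : FirstOrder.Language.{0, 0}} [L.IsRelational] (k : ℕ) (A : FinStr L) :
    FinStr (L.sum (copyLanguage k)) where
  carrier := Fin k × A.carrier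
  str :=
    { funMap := fun f =>
        Sum.elim (fun g => isEmptyElim g) (fun g : Empty => g.elim) f
      RelMap := fun {n} R => match n, R with
        | _, .inl R => fun t =>
            (∃ i, ∀ j, (t j).1 = i) ∧ FirstOrder.Language.Structure.RelMap R fun j => (t j).2
        | _, .inr .copy => fun t => (t 0).2 = (t 1).2
        | _, .inr (.layer i) => fun t => (t 0).1 = i }

/-- `k`-copying. -/
def copying (L : FirstOrder.Language.{0, 0}) [L.IsRelational] (k : ℕ) :
    Transduction L (L.sum (copyLanguage k)) :=
  fun A B => B.Iso (copyStr k A)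

/-- The unary predicates added by `k`-coloring. -/
inductive ColorRel (k : ℕ) : ℕ → Type
  | color (i : Fin k) : ColorRel k 1

/-- The vocabulary of the unary predicates added by `k`-coloring. -/
def colorLanguage (k : ℕ) : FirstOrder.Language.{0, 0} := ⟨fun _ => Empty, ColorRel k⟩

/-- The structure `A` expanded by unary predicates that are interpreted as `X 0, …, X (k - 1)`. -/
def colorStr {L : FirstOrder.Language.{0, 0}} [L.IsRelational] {k : ℕ} (A : FinStr L)
    (X : Fin k → Set A.carrier) : FinStr (L.sum (colorLanguage k)) where
  carrier := A.carrier
  str :=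
    { funMap := fun f =>
        Sum.elim (fun g => isEmptyElim g) (fun g : Empty => g.elim) f
      RelMap := fun {n} R => match n, R with
        | _, .inl R => fun t => FirstOrder.Language.Structure.RelMap R t
        | _, .inr (.color i) => fun t => t 0 ∈ X i }

/-- `k`-coloring: the outputs are all expansions of the input by `k` unary predicates. -/
def coloring (L : FirstOrder.Language.{0, 0}) [L.IsRelational] (k : ℕ) :
    Transduction L (L.sum (colorLanguage k)) :=
  fun A B => ∃ X : Fin k → Set A.carrier, B.Iso (colorStr A X)

/-- An interpretation of structures over `L'` in structures over `L`: a sentence `dom` (domain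
check), a formula `univ` with one free element variable, and for each relation symbol `R` of `L'`
a formula `rel R` with as many free element variables as the arity of `R`. -/
structure Interpretation (L L' : FirstOrder.Language.{0, 0}) where
  dom : MSOFormula L 0 0
  univ : MSOFormula L 1 0
  rel : ∀ {n : ℕ}, L'.Relations n → MSOFormula L n 0

/-- The structure over `L'` interpreted in `A`: its universe consists of the elements satisfying
`univ`, and each relation symbol `R` is interpreted as the set of tuples satisfying `rel R`. -/
def Interpretation.outStr {L L' : FirstOrder.Language.{0, 0}} [L'.IsRelational]
    (I : Interpretation L L') (A : FinStr L) : FinStr L' where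
  carrier := {a : A.carrier // I.univ.Realize (fun _ => a) Fin.elim0}
  str :=
    { funMap := fun f => isEmptyElim f
      RelMap := fun R t => (I.rel R).Realize (fun j => (t j : A.carrier)) Fin.elim0 }

/-- The transduction given by an interpretation; there is no output if the domain check fails. -/
def Interpretation.transduction {L L' : FirstOrder.Language.{0, 0}} [L'.IsRelational]
    (I : Interpretation L L') : Transduction L L' :=
  fun A B => I.dom.Realize (M := A.carrier) Fin.elim0 Fin.elim0 ∧ B.Iso (I.outStr A)

/-- MSO transductions: finite compositions of copying, coloring and interpretation, over finite
relational vocabularies. -/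
inductive IsMSO : {L L' : FirstOrder.Language.{0, 0}} → Transduction L L' → Prop
  | copying {L : FirstOrder.Language.{0, 0}} [L.IsRelational] [Finite L.Symbols] (k : ℕ) :
      IsMSO (copying L k)
  | coloring {L : FirstOrder.Language.{0, 0}} [L.IsRelational] [Finite L.Symbols] (k : ℕ) :
      IsMSO (coloring L k)
  | interpretation {L L' : FirstOrder.Language.{0, 0}} [L.IsRelational] [Finite L.Symbols]
      [L'.IsRelational] [Finite L'.Symbols] (I : Interpretation L L') :
      IsMSO I.transduction
  | comp {L₁ L₂ L₃ : FirstOrder.Language.{0, 0}} {S : Transduction L₁ L₂} {T : Transduction L₂ L₃} :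
      IsMSO S → IsMSO T → IsMSO (S.comp T)

/-! ### Graphs as structures -/

inductive GraphRel : ℕ → Type
  | incident : GraphRel 2

/-- The vocabulary of graphs. -/
def graphLanguage : FirstOrder.Language.{0, 0} := ⟨fun _ => Empty, GraphRel⟩

/-- A finite simple graph as a structure: the universe consists of the vertices and the edges, and
`incident` selects the pairs `(v, e)` where the vertex `v` is an endpoint of the edge `e`. -/
def graphStr {V : Type} [Finite V] (G : SimpleGraph V) : FinStr graphLanguage where
  carrier := V ⊕ G.edgeSet
  str :=
    { funMap := fun f => Empty.elim f
      RelMap := fun {n} R => match n, R with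
        | _, .incident => fun t =>
            ∃ (v : V) (e : G.edgeSet), t 0 = .inl v ∧ t 1 = .inr e ∧ v ∈ (e : Sym2 V) }

/-! ### Tree decompositions -/

/-- A tree decomposition of `G` with set of nodes `N`. The nodes form a rooted forest, given by the
partial function `parent`; the roots are the nodes without a parent. -/
structure TreeDecomposition {V : Type} (G : SimpleGraph V) (N : Type) where
  parent : N → Option N
  /-- No node is a proper ancestor of itself. -/
  acyclic : ∀ x, ¬ Relation.TransGen (fun y z => parent y = some z) x x
  bag : N → Set V
  /-- The nodes whose bags contain a given vertex form a nonempty connected part of the forest. -/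
  connected : ∀ v : V,
    ((SimpleGraph.fromRel fun y z => parent y = some z).induce {x | v ∈ bag x}).Connected
  /-- Both endpoints of every edge lie together in some bag. -/
  edge_covered : ∀ u v : V, G.Adj u v → ∃ x, u ∈ bag x ∧ v ∈ bag x

namespace TreeDecomposition

variable {V N : Type} {G : SimpleGraph V} (t : TreeDecomposition G N)

/-- The intersection of the bag of `x` with the bag of its parent; empty if `x` is a root. -/
def adhesion (x : N) : Set V := {v | v ∈ t.bag x ∧ ∃ y, t.parent x = some y ∧ v ∈ t.bag y}

/-- The bag of `x` without its adhesion. -/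
def margin (x : N) : Set V := t.bag x \ t.adhesion x

/-- The union of the bags of all descendants of `x`, including `x` itself. -/
def cone (x : N) : Set V :=
  {v | ∃ y, Relation.ReflTransGen (fun z w => t.parent z = some w) y x ∧ v ∈ t.bag y}

/-- The cone of `x` without the adhesion of `x`. -/
def component (x : N) : Set V := t.cone x \ t.adhesion x

/-- A tree decomposition is sane if, for every node `x`, the margin of `x` is nonempty, the cone
and the component of `x` induce connected subgraphs, and every vertex of the adhesion of `x` has a
neighbor in the component of `x`. -/
structure IsSane : Prop where
  margin_nonempty : ∀ x, (t.margin x).Nonempty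
  cone_connected : ∀ x, (G.induce (t.cone x)).Connected
  component_connected : ∀ x, (G.induce (t.component x)).Connected
  adhesion_neighbor : ∀ x, ∀ v ∈ t.adhesion x, ∃ u ∈ t.component x, G.Adj v u

/-- The family of adhesions. -/
def adhesions : Set (Set V) := Set.range t.adhesion

end TreeDecomposition

inductive TreeDecompositionRel : ℕ → Type
  | incident : TreeDecompositionRel 2
  | node : TreeDecompositionRel 1
  | parent : TreeDecompositionRel 2
  | bag : TreeDecompositionRel 2

/-- The vocabulary of tree decompositions. -/
def treeDecompositionLanguage : FirstOrder.Language.{0, 0} := ⟨fun _ => Empty, TreeDecompositionRel⟩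

/-- A tree decomposition of `G` as a structure: the universe consists of the vertices and the edges
of `G` and the nodes, `incident` is as for graphs, `node` selects the nodes, `parent` selects the
pairs `(x, y)` where `y` is the parent of `x`, and `bag` selects the pairs `(v, x)` where `v` is in
the bag of `x`. -/
def TreeDecomposition.toStr {V N : Type} [Finite V] [Finite N] {G : SimpleGraph V}
    (t : TreeDecomposition G N) : FinStr treeDecompositionLanguage where
  carrier := (V ⊕ G.edgeSet) ⊕ N
  str :=
    { funMap := fun f => Empty.elim f
      RelMap := fun {n} R => match n, R with
        | _, .incident => fun s =>
            ∃ (v : V) (e : G.edgeSet),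
              s 0 = .inl (.inl v) ∧ s 1 = .inl (.inr e) ∧ v ∈ (e : Sym2 V)
        | _, .node => fun s => ∃ x : N, s 0 = .inr x
        | _, .parent => fun s =>
            ∃ x y : N, s 0 = .inr x ∧ s 1 = .inr y ∧ t.parent x = some y
        | _, .bag => fun s =>
            ∃ (v : V) (x : N), s 0 = .inl (.inl v) ∧ s 1 = .inr x ∧ v ∈ t.bag x }

/-! ### Guidance systems -/

/-- An in-tree in `G`: a subgraph that is a tree, with a distinguished root, towards which all
edges are thought of as directed. -/
structure InTree {V : Type} (G : SimpleGraph V) where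
  tree : G.Subgraph
  isTree : tree.coe.IsTree
  root : V
  root_mem : root ∈ tree.verts

/-- A guidance system over `G` is a family of in-trees in `G`. -/
abbrev GuidanceSystem {V : Type} (G : SimpleGraph V) : Type := Set (InTree G)

namespace GuidanceSystem

variable {V : Type} {G : SimpleGraph V} (Λ : GuidanceSystem G)

/-- The set `Λ(u)` of the roots of those in-trees of `Λ` that contain `u`. -/
def reach (u : V) : Set V := {v | ∃ s ∈ Λ, u ∈ s.tree.verts ∧ s.root = v}

/-- `Λ` captures a family of vertex sets if each of its members is contained in some `Λ(u)`. -/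
def Captures (𝒳 : Set (Set V)) : Prop := ∀ X ∈ 𝒳, ∃ u, X ⊆ reach Λ u

/-- `Λ` is `k`-colorable if its in-trees can be colored with `k` colors so that distinct in-trees of
the same color are vertex-disjoint. -/
def Colorable (k : ℕ) : Prop :=
  ∃ c : {s : InTree G // s ∈ Λ} → Fin k,
    ∀ s s', s ≠ s' → c s = c s' → Disjoint s.1.tree.verts s'.1.tree.verts

end GuidanceSystem

end MSOTransduction

open MSOTransduction

/-!
Let `t` be a sane tree decomposition of `G`. Every vertex `v` lies in the margin of exactly one
node, its home, and the component `α(x)` consists of the vertices whose home is a descendant of `x`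
(`TreeDecomposition.mem_component_iff`). By saneness `α(x)` is connected and the adhesion `σ(x)` is
its neighborhood. Hence `t` can be read off from one vertex in the margin of every node together
with the family of components, and the task is to encode the components by boundedly many sets of
vertices and edges.

A `k`-colored guidance system is encoded by the sets of edges and of roots of each color. A set
captured at a vertex `u` is then described by `u` and a subset of the `k` colors, so boundedly many
sets of vertices `u` encode the family of all adhesions. They do not tell which component of
`G - σ(z)` is `α(z)`, nor which adhesion belongs to a given node. For this purpose, let `z` be a
node with parent `p`. Since `α(p)` is connected, `σ(z)` meets the margin of `p`
(`TreeDecomposition.exists_link`). Choose such a vertex `m`, the anchor of `z`, and an edge from `m`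
to a vertex `a` in `α(z)`, the link of `z`. For every vertex `u` that encodes an adhesion, the color
of the in-tree rooted at the anchor is recorded as well. The adhesions recorded with anchor `m`
belong to children of the home of `m`, that is, to siblings of `z`, and such adhesions are disjoint
from `α(z)`. Therefore `α(z)` is exactly the set of vertices that none of these adhesions separates
from `a` (`Encoding.region_iff`). The links form a bipartite graph
(`TreeDecomposition.exists_bipartition`), so two classes of vertices and two classes of links
suffice to tell their anchors.

Conversely, the transduction guesses an arbitrary coloring and checks by an MSO sentence that the
relations it describes form a sane tree decomposition whose adhesions are captured by the guessed
in-trees. Instead of requiring the edges of one color to form a forest, the sentence requires the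
roots of one color to lie in different components, and spanning trees of these components are the
in-trees (`ColoredGraph.IsCaptured.exists_guidanceSystem`). The check is definable because `VDef`,
definability of relations between vertices, is closed under first-order operations and under
reachability (`VDef.reflTransGen`). The nodes are at first identified with vertices, and a copying
step followed by a first-order interpretation makes them new elements (`splitting_iso`).
-/

namespace MSOTransduction

open FirstOrder Relation
open FirstOrder.Language.Structure (RelMap)

/-! ### Relational vocabularies and isomorphism invariance -/

instance : graphLanguage.IsRelational := fun _ => inferInstanceAs (IsEmpty Empty)

instance (k : ℕ) : (colorLanguage k).IsRelational := fun _ => inferInstanceAs (IsEmpty Empty)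

instance (k : ℕ) : (copyLanguage k).IsRelational := fun _ => inferInstanceAs (IsEmpty Empty)

instance : treeDecompositionLanguage.IsRelational := fun _ => inferInstanceAs (IsEmpty Empty)

section Invariance

variable {L L' : FirstOrder.Language.{0, 0}}

theorem MSOFormula.realize_equiv {M N : Type} [L.Structure M] [L.Structure N] (e : M ≃[L] N)
    {n m : ℕ} (φ : MSOFormula L n m) (x : Fin n → M) (X : Fin m → Set M) :
    φ.Realize (fun i => e (x i)) (fun j => e '' X j) ↔ φ.Realize x X := by
  induction φ with
  | falsum => rfl
  | equal i j => exact e.injective.eq_iff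
  | rel R v => exact e.map_rel' R fun a => x (v a)
  | mem i j => exact e.injective.mem_set_image
  | imp φ ψ hφ hψ => exact imp_congr (hφ _ _) (hψ _ _)
  | allElem φ hφ =>
    refine e.toEquiv.surjective.forall.trans (forall_congr' fun a => ?_)
    rw [← hφ]
    exact iff_of_eq (congrArg (φ.Realize · _) (Fin.comp_snoc (⇑e) x a).symm)
  | allSet φ hφ =>
    refine e.toEquiv.surjective.image_surjective.forall.trans (forall_congr' fun Y => ?_)
    rw [← hφ]
    exact iff_of_eq (congrArg (φ.Realize _) (Fin.comp_snoc (fun Z : Set _ => e '' Z) X Y).symm)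

theorem FinStr.Iso.refl (A : FinStr L) : A.Iso A := ⟨FirstOrder.Language.Equiv.refl L _⟩

theorem FinStr.Iso.symm {A B : FinStr L} : A.Iso B → B.Iso A := fun ⟨e⟩ => ⟨e.symm⟩

theorem FinStr.Iso.trans {A B C : FinStr L} : A.Iso B → B.Iso C → A.Iso C :=
  fun ⟨e⟩ ⟨f⟩ => ⟨f.comp e⟩

theorem FinStr.Iso.of_equiv [L.IsRelational] {A B : FinStr L} (e : A.carrier ≃ B.carrier)
    (h : ∀ {n : ℕ} (R : L.Relations n) (t : Fin n → A.carrier),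
      RelMap R (fun j => e (t j)) ↔ RelMap R t) :
    A.Iso B :=
  ⟨{ e with
      map_fun' := fun f => isEmptyElim f
      map_rel' := fun R t => h R t }⟩

theorem copyStr_iso [L.IsRelational] (k : ℕ) {A B : FinStr L} (h : A.Iso B) :
    (copyStr k A).Iso (copyStr k B) := by
  obtain ⟨e⟩ := h
  refine .of_equiv (Equiv.prodCongr (Equiv.refl _) e.toEquiv) fun {n} R t => ?_
  rcases R with R | R
  · exact and_congr Iff.rfl (e.map_rel' R fun j => (t j).2)
  · cases R with
    | copy => exact e.injective.eq_iff
    | layer i => exact Iff.rfl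

theorem Interpretation.outStr_iso [L'.IsRelational] (I : Interpretation L L') {A B : FinStr L}
    (h : A.Iso B) : (I.outStr A).Iso (I.outStr B) := by
  obtain ⟨e⟩ := h
  have key : ∀ {n : ℕ} (φ : MSOFormula L n 0) (x : Fin n → A.carrier),
      φ.Realize (fun i => e (x i)) Fin.elim0 ↔ φ.Realize x Fin.elim0 := fun φ x => by
    rw [← φ.realize_equiv e x Fin.elim0]
    exact iff_of_eq (congrArg _ (Subsingleton.elim _ _))
  exact .of_equiv (e.toEquiv.subtypeEquiv fun a => (key I.univ fun _ => a).symm)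
    fun R t => key (I.rel R) fun j => (t j).1

theorem Interpretation.dom_iso (I : Interpretation L L') {A B : FinStr L}
    (h : A.Iso B) : I.dom.Realize (M := A.carrier) Fin.elim0 Fin.elim0 ↔
      I.dom.Realize (M := B.carrier) Fin.elim0 Fin.elim0 := by
  obtain ⟨e⟩ := h
  rw [← I.dom.realize_equiv e]
  exact iff_of_eq (congrArg₂ _ (Subsingleton.elim _ _) (Subsingleton.elim _ _))

end Invariance

/-! ### Finiteness of the vocabularies -/

theorem finite_symbols {L : FirstOrder.Language.{0, 0}} [L.IsRelational]
    (h : Finite (Σ n, L.Relations n)) : Finite L.Symbols :=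
  have : IsEmpty (Σ n, L.Functions n) := ⟨fun f => isEmptyElim f.2⟩
  inferInstanceAs (Finite ((Σ n, L.Functions n) ⊕ Σ n, L.Relations n))

theorem finite_symbols_sum {L L' : FirstOrder.Language.{0, 0}} [L.IsRelational] [L'.IsRelational]
    (h : Finite L.Symbols) (h' : Finite L'.Symbols) : Finite (L.sum L').Symbols := by
  have h₁ : Finite (Σ n, L.Relations n) :=
    Finite.of_injective (β := L.Symbols) Sum.inr Sum.inr_injective
  have h₂ : Finite (Σ n, L'.Relations n) :=
    Finite.of_injective (β := L'.Symbols) Sum.inr Sum.inr_injective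
  refine finite_symbols (Finite.of_surjective
    (Sum.elim (fun R : Σ n, L.Relations n => ⟨R.1, .inl R.2⟩)
      fun R : Σ n, L'.Relations n => (⟨R.1, .inr R.2⟩ : Σ n, (L.sum L').Relations n)) ?_)
  rintro ⟨n, R | R⟩
  · exact ⟨.inl ⟨n, R⟩, rfl⟩
  · exact ⟨.inr ⟨n, R⟩, rfl⟩

instance : Finite graphLanguage.Symbols :=
  finite_symbols (Finite.of_surjective (fun _ : Unit => ⟨2, GraphRel.incident⟩)
    (by rintro ⟨_, ⟨⟩⟩; exact ⟨(), rfl⟩))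

instance (k : ℕ) : Finite (colorLanguage k).Symbols :=
  finite_symbols (Finite.of_surjective (fun i : Fin k => ⟨1, ColorRel.color i⟩)
    (by rintro ⟨_, ⟨i⟩⟩; exact ⟨i, rfl⟩))

instance (k : ℕ) : Finite (copyLanguage k).Symbols :=
  finite_symbols (Finite.of_surjective
    (Option.elim · ⟨2, CopyRel.copy⟩ fun i : Fin k => ⟨1, CopyRel.layer i⟩)
    (by rintro ⟨_, _ | i⟩; exacts [⟨none, rfl⟩, ⟨some i, rfl⟩]))

instance : Finite treeDecompositionLanguage.Symbols :=
  finite_symbols (Finite.of_surjective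
    (![⟨2, TreeDecompositionRel.incident⟩, ⟨1, TreeDecompositionRel.node⟩,
      ⟨2, TreeDecompositionRel.parent⟩, ⟨2, TreeDecompositionRel.bag⟩] :
      Fin 4 → Σ n, TreeDecompositionRel n)
    (by rintro ⟨_, _ | _⟩; exacts [⟨0, rfl⟩, ⟨1, rfl⟩, ⟨2, rfl⟩, ⟨3, rfl⟩]))

instance {L L' : FirstOrder.Language.{0, 0}} [L.IsRelational] [L'.IsRelational]
    [h : Finite L.Symbols] [h' : Finite L'.Symbols] : Finite (L.sum L').Symbols :=
  finite_symbols_sum h h'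

/-! ### Definability of relations between vertices -/

/-- A finite graph with unary predicates, indexed by `κ`, on its vertices and edges. -/
structure ColoredGraph (κ : Type) where
  V : Type
  [finite : Finite V]
  G : SimpleGraph V
  color : κ → Set (V ⊕ G.edgeSet)

attribute [instance] ColoredGraph.finite

namespace ColoredGraph

variable {κ : Type}

/-- The vertex `v` has color `c`. -/
def HasColor (D : ColoredGraph κ) (c : κ) (v : D.V) : Prop := .inl v ∈ D.color c

/-- There is an edge of color `c` between `v` and `w`. -/
def ColorAdj (D : ColoredGraph κ) (c : κ) (v w : D.V) : Prop :=
  ∃ h : D.G.Adj v w, .inr ⟨s(v, w), h⟩ ∈ D.color c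

end ColoredGraph

/-- Distinct vertices determine the edge between them by incidence. -/
theorem exists_edge_iff {V : Type} {G : SimpleGraph V} {v w : V} {p : G.edgeSet → Prop} :
    (∃ h : G.Adj v w, p ⟨s(v, w), h⟩) ↔
      v ≠ w ∧ ∃ e : G.edgeSet, v ∈ e.1 ∧ w ∈ e.1 ∧ p e := by
  constructor
  · exact fun ⟨h, hp⟩ => ⟨h.ne, _, Sym2.mem_mk_left _ _, Sym2.mem_mk_right _ _, hp⟩
  · rintro ⟨hne, ⟨e, he⟩, hv, hw, hp⟩
    obtain rfl : e = s(v, w) := ((Sym2.mem_and_mem_iff hne).1 ⟨hv, hw⟩)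
    exact ⟨he, hp⟩

variable (κ : Type) [Finite κ]

/-- The vocabulary of graphs with unary predicates indexed by `κ`. -/
noncomputable abbrev coloredLanguage : FirstOrder.Language.{0, 0} :=
  graphLanguage.sum (colorLanguage (Nat.card κ))

variable {κ}

/-- A colored graph as an output of the coloring transduction. -/
noncomputable abbrev ColoredGraph.toStr (D : ColoredGraph κ) : FinStr (coloredLanguage κ) :=
  colorStr (graphStr D.G) fun i => D.color ((Finite.equivFin κ).symm i)

/-- The vertices and edges of a colored graph. -/
abbrev ColoredGraph.Elem (D : ColoredGraph κ) : Type := D.V ⊕ D.G.edgeSet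

noncomputable instance (D : ColoredGraph κ) : (coloredLanguage κ).Structure D.Elem := D.toStr.str

/-- A relation between the vertices of colored graphs is definable if it is expressed by an MSO
formula over the structures that represent colored graphs. The formula may have any number of free
set variables, on which its truth does not depend: this spares a weakening operation on formulas
when set quantifiers are introduced. -/
def VDef {n : ℕ} (P : ∀ D : ColoredGraph κ, (Fin n → D.V) → Prop) : Prop :=
  ∀ m, ∃ φ : MSOFormula (coloredLanguage κ) n m, ∀ (D : ColoredGraph κ) (x : Fin n → D.V)
    (Y : Fin m → Set D.Elem),
    φ.Realize (M := D.Elem) (fun i => .inl (x i)) Y ↔ P D x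

namespace MSOFormula

variable {n m : ℕ}

/-- The negation of a formula. -/
def neg {L : FirstOrder.Language.{0, 0}} (φ : MSOFormula L n m) : MSOFormula L n m := φ.imp falsum

/-- The incidence predicate over colored graphs. -/
noncomputable def incident (i j : Fin n) : MSOFormula (coloredLanguage κ) n m :=
  rel (.inl GraphRel.incident : (coloredLanguage κ).Relations 2) ![i, j]

/-- The color predicate `c` over colored graphs. -/
noncomputable def color (c : κ) (i : Fin n) : MSOFormula (coloredLanguage κ) n m :=
  rel (.inr (ColorRel.color (Finite.equivFin κ c)) : (coloredLanguage κ).Relations 1) ![i]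

/-- The formula saying that a variable is a vertex: nothing is incident to it. -/
noncomputable def isVertex (i : Fin n) : MSOFormula (coloredLanguage κ) n m :=
  allElem (incident (Fin.last n) i.castSucc).neg

variable (D : ColoredGraph κ) (x : Fin n → D.Elem) (Y : Fin m → Set D.Elem)

theorem realize_neg {L : FirstOrder.Language.{0, 0}} {M : Type} [L.Structure M]
    (φ : MSOFormula L n m) (x : Fin n → M) (Y : Fin m → Set M) :
    φ.neg.Realize x Y ↔ ¬ φ.Realize x Y := Iff.rfl

theorem realize_incident (i j : Fin n) : (incident (κ := κ) i j).Realize x Y ↔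
    ∃ (v : D.V) (e : D.G.edgeSet), x i = .inl v ∧ x j = .inr e ∧ v ∈ (e : Sym2 D.V) := Iff.rfl

theorem realize_color (c : κ) (i : Fin n) : (color c i).Realize x Y ↔ x i ∈ D.color c := by
  change x i ∈ D.color ((Finite.equivFin κ).symm (Finite.equivFin κ c)) ↔ _
  rw [Equiv.symm_apply_apply]

theorem realize_isVertex (i : Fin n) :
    (isVertex (κ := κ) i).Realize x Y ↔ ∃ v : D.V, x i = .inl v := by
  simp only [isVertex, Realize, realize_neg, realize_incident, Fin.snoc_last, Fin.snoc_castSucc]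
  constructor
  · intro h
    rcases hi : x i with v | e
    · exact ⟨v, rfl⟩
    · exact absurd ⟨_, e, rfl, hi, Sym2.out_fst_mem _⟩ (h (.inl (Quot.out e.1).1))
  · rintro ⟨v, hv⟩ a ⟨_, e, -, he, -⟩
    exact Sum.inl_ne_inr (hv.symm.trans he)

end MSOFormula

namespace VDef

open MSOFormula ColoredGraph

variable {n : ℕ} {P Q : ∀ D : ColoredGraph κ, (Fin n → D.V) → Prop}

theorem congr (hP : VDef P) (h : ∀ D x, P D x ↔ Q D x) : VDef Q := fun m =>
  let ⟨φ, hφ⟩ := hP m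
  ⟨φ, fun D x Y => (hφ D x Y).trans (h D x)⟩

theorem imp (hP : VDef P) (hQ : VDef Q) : VDef fun D x => P D x → Q D x := fun m =>
  let ⟨φ, hφ⟩ := hP m
  let ⟨ψ, hψ⟩ := hQ m
  ⟨φ.imp ψ, fun D x Y => imp_congr (hφ D x Y) (hψ D x Y)⟩

theorem false : VDef fun (D : ColoredGraph κ) (_ : Fin n → D.V) => False :=
  fun _ => ⟨.falsum, fun _ _ _ => Iff.rfl⟩

theorem not (hP : VDef P) : VDef fun D x => ¬ P D x := hP.imp false

theorem const (p : Prop) : VDef fun (D : ColoredGraph κ) (_ : Fin n → D.V) => p := by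
  by_cases h : p
  · exact false.not.congr fun _ _ => by simp [h]
  · exact false.congr fun _ _ => by simp [h]

theorem and (hP : VDef P) (hQ : VDef Q) : VDef fun D x => P D x ∧ Q D x :=
  (hP.imp hQ.not).not.congr fun _ _ => by tauto

theorem or (hP : VDef P) (hQ : VDef Q) : VDef fun D x => P D x ∨ Q D x :=
  (hP.not.imp hQ).congr fun _ _ => by tauto

/-- The bound variable is the last one of the longer valuation, in accordance with the convention
for `MSOFormula`. The quantifier ranges over vertices only, hence the guard `isVertex`. -/
theorem all {P : ∀ D : ColoredGraph κ, (Fin n → D.V) → D.V → Prop}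
    (hP : VDef fun D (x : Fin (n + 1) → D.V) => P D (Fin.init x) (x (Fin.last n))) :
    VDef fun D x => ∀ v, P D x v := fun m => by
  obtain ⟨φ, hφ⟩ := hP m
  refine ⟨allElem ((isVertex (Fin.last n)).imp φ), fun D x Y => ?_⟩
  have key : ∀ v : D.V, φ.Realize (M := D.Elem)
      (Fin.snoc (α := fun _ => D.Elem) (fun i => .inl (x i)) (.inl v)) Y ↔ P D x v := by
    intro v
    have := hφ D (Fin.snoc (α := fun _ => D.V) x v) Y
    beta_reduce at this
    rw [Fin.init_snoc, Fin.snoc_last] at this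
    rw [← this]
    exact iff_of_eq (congrArg (φ.Realize · Y)
      (Fin.comp_snoc (Sum.inl : D.V → D.Elem) x v).symm)
  simp only [Realize, realize_isVertex, Fin.snoc_last]
  constructor
  · exact fun h v => (key v).1 (h _ ⟨v, rfl⟩)
  · rintro h _ ⟨v, rfl⟩
    exact (key v).2 (h v)

theorem ex {P : ∀ D : ColoredGraph κ, (Fin n → D.V) → D.V → Prop}
    (hP : VDef fun D (x : Fin (n + 1) → D.V) => P D (Fin.init x) (x (Fin.last n))) :
    VDef fun D x => ∃ v, P D x v :=
  (VDef.all (P := fun D x v => ¬ P D x v) hP.not).not.congr fun _ _ => by simp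

theorem all_finite {ι : Type} [Finite ι] {P : ι → ∀ D : ColoredGraph κ, (Fin n → D.V) → Prop}
    (hP : ∀ i, VDef (P i)) : VDef fun D x => ∀ i, P i D x := by
  classical
  have := Fintype.ofFinite ι
  have key : ∀ s : Finset ι, VDef fun D x => ∀ i ∈ s, P i D x := fun s => by
    induction s using Finset.induction_on with
    | empty => exact (const True).congr fun _ _ => by simp
    | insert i s _ ih => exact ((hP i).and ih).congr fun _ _ => by simp
  exact (key Finset.univ).congr fun _ _ => by simp

theorem ex_finite {ι : Type} [Finite ι] {P : ι → ∀ D : ColoredGraph κ, (Fin n → D.V) → Prop}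
    (hP : ∀ i, VDef (P i)) : VDef fun D x => ∃ i, P i D x :=
  (all_finite fun i => (hP i).not).not.congr fun _ _ => by simp

theorem eq (i j : Fin n) : VDef fun (_ : ColoredGraph κ) x => x i = x j :=
  fun _ => ⟨.equal i j, fun _ _ _ => Sum.inl_injective.eq_iff⟩

theorem hasColor (c : κ) (i : Fin n) : VDef fun D x => D.HasColor c (x i) :=
  fun _ => ⟨color c i, fun D _ _ => realize_color D _ _ c i⟩

/-- Adjacency through an edge with a definable property is definable. -/
theorem exists_edge {p : ∀ D : ColoredGraph κ, D.G.edgeSet → Prop}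
    (hp : ∀ n m (i : Fin n), ∃ ψ : MSOFormula (coloredLanguage κ) n m,
      ∀ (D : ColoredGraph κ) (x : Fin n → D.Elem) (Y : Fin m → Set D.Elem) (e : D.G.edgeSet),
        x i = .inr e → (ψ.Realize x Y ↔ p D e)) (i j : Fin n) :
    VDef fun D x => ∃ h : D.G.Adj (x i) (x j), p D ⟨s(x i, x j), h⟩ := fun m => by
  obtain ⟨ψ, hψ⟩ := hp (n + 1) m (Fin.last n)
  refine ⟨((equal i j).neg.imp (allElem ((incident i.castSucc (Fin.last n)).imp
    ((incident j.castSucc (Fin.last n)).imp ψ.neg)))).neg, fun D x Y => ?_⟩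
  refine Iff.trans ?_ (exists_edge_iff (p := p D)).symm
  simp only [Realize, realize_neg, realize_incident, Fin.snoc_last, Fin.snoc_castSucc]
  constructor
  · intro h
    by_contra h'
    refine h fun hne a hi hj ha => h' ⟨fun h => hne (congrArg _ h), ?_⟩
    obtain ⟨v, e, hv, rfl, hve⟩ := hi
    obtain ⟨w, e', hw, he, hwe⟩ := hj
    cases Sum.inl_injective hv
    cases Sum.inl_injective hw
    cases Sum.inr_injective he
    exact ⟨e, hve, hwe, (hψ D _ _ e (Fin.snoc_last _ _)).1 ha⟩
  · rintro ⟨hne, e, hi, hj, he⟩ h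
    exact h (fun h => hne (Sum.inl_injective h)) (.inr e) ⟨_, e, rfl, rfl, hi⟩
      ⟨_, e, rfl, rfl, hj⟩ ((hψ D _ _ e (Fin.snoc_last _ _)).2 he)

theorem colorAdj (c : κ) (i j : Fin n) : VDef fun D x => D.ColorAdj c (x i) (x j) :=
  (exists_edge (p := fun D e => (.inr e : D.Elem) ∈ D.color c)
    (fun _ _ i => ⟨color c i, fun D x Y e he => by rw [realize_color, he]⟩) i j).congr
    fun _ _ => Iff.rfl

theorem adj (i j : Fin n) : VDef fun (D : ColoredGraph κ) x => D.G.Adj (x i) (x j) :=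
  (exists_edge (p := fun _ _ => True)
    (fun _ _ _ => ⟨falsum.neg, fun _ _ _ _ _ => by simp [realize_neg, Realize]⟩) i j).congr
    fun _ _ => by simp

/-- Reachability along a definable relation is definable: `b` is reachable from `a` if every set
that contains `a` and is closed under the relation contains `b`. -/
theorem reflTransGen {R : ∀ D : ColoredGraph κ, (Fin n → D.V) → D.V → D.V → Prop}
    (hR : VDef fun D (x : Fin (n + 1 + 1) → D.V) =>
      R D (Fin.init (Fin.init x)) (x (Fin.last n).castSucc) (x (Fin.last (n + 1)))) (i j : Fin n) :
    VDef fun D x => ReflTransGen (R D x) (x i) (x j) := fun m => by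
  obtain ⟨φ, hφ⟩ := hR (m + 1)
  let p : Fin (n + 1 + 1) := (Fin.last n).castSucc
  let q : Fin (n + 1 + 1) := Fin.last (n + 1)
  refine ⟨allSet ((mem i (Fin.last m)).imp ((allElem ((isVertex (Fin.last n)).imp
    (allElem ((isVertex q).imp ((mem p (Fin.last m)).imp (φ.imp (mem q (Fin.last m)))))))).imp
      (mem j (Fin.last m)))), fun D x Y => ?_⟩
  have key : ∀ (v w : D.V) (Y : Fin (m + 1) → Set (D.Elem)),
      φ.Realize (M := D.Elem) (Fin.snoc (α := fun _ => D.Elem)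
        (Fin.snoc (α := fun _ => D.Elem) (fun i => .inl (x i)) (.inl v)) (.inl w)) Y ↔
      R D x v w := by
    intro v w Y
    have := hφ D (Fin.snoc (α := fun _ => D.V) (Fin.snoc (α := fun _ => D.V) x v) w) Y
    beta_reduce at this
    rw [Fin.init_snoc, Fin.init_snoc, Fin.snoc_last, Fin.snoc_castSucc, Fin.snoc_last] at this
    rw [← this]
    refine iff_of_eq (congrArg (φ.Realize · Y) ?_)
    refine Eq.trans ?_ (Fin.comp_snoc (Sum.inl : D.V → D.Elem) _ w).symm
    rw [Fin.comp_snoc]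
    rfl
  simp only [Realize, realize_isVertex, Fin.snoc_last, Fin.snoc_castSucc, p, q]
  constructor
  · intro h
    obtain ⟨v, hv, hvj⟩ := h {a | ∃ v, a = .inl v ∧ ReflTransGen (R D x) (x i) v}
      ⟨_, rfl, .refl⟩ (by
        rintro _ ⟨v, rfl⟩ _ ⟨w, rfl⟩ ⟨v', hv, hiv⟩ hvw
        cases Sum.inl_injective hv
        exact ⟨w, rfl, hiv.tail ((key _ _ _).1 hvw)⟩)
    cases Sum.inl_injective hv
    exact hvj
  · intro h Z hi hZ
    have : ∀ w, ReflTransGen (R D x) (x i) w → (.inl w : D.Elem) ∈ Z := by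
      intro w hw
      induction hw with
      | refl => exact hi
      | tail _ hvw ih => exact hZ _ ⟨_, rfl⟩ _ ⟨_, rfl⟩ ih ((key _ _ _).2 hvw)
    exact this _ h

end VDef

/-! ### The relations encoded by a coloring -/

/-- The colors by which a sane tree decomposition and a `k`-colored guidance system are encoded. -/
inductive Label (k : ℕ) : Type
  /-- The edges of the in-trees of color `i`. -/
  | treeEdge (i : Fin k)
  /-- The roots of the in-trees of color `i`. -/
  | treeRoot (i : Fin k)
  /-- The vertices `u` such that the roots with color in `C` of the in-trees through `u` are the
  adhesion of a node whose anchor is the root with color `j`. -/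
  | guide (C : Finset (Fin k)) (j : Fin k)
  /-- One vertex from the margin of every node. -/
  | rep
  /-- One side of a bipartition of the vertices, by which links are oriented. -/
  | side
  /-- The links of the nodes whose anchor is on the selected side (`true`) or on the other side
  (`false`). -/
  | link (b : Bool)

instance (k : ℕ) : Finite (Label k) :=
  Finite.of_surjective
    (Sum.elim (Sum.elim .treeEdge .treeRoot)
      (Sum.elim (fun p : Finset (Fin k) × Fin k => .guide p.1 p.2)
        (Sum.elim .link fun b : Bool => bif b then .rep else .side)))
    (by
      rintro (i | i | ⟨C, j⟩ | _ | _ | b)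
      exacts [⟨.inl (.inl i), rfl⟩, ⟨.inl (.inr i), rfl⟩, ⟨.inr (.inl (C, j)), rfl⟩,
        ⟨.inr (.inr (.inr true)), rfl⟩, ⟨.inr (.inr (.inr false)), rfl⟩,
        ⟨.inr (.inr (.inl b)), rfl⟩])

variable {k : ℕ}

namespace ColoredGraph

variable (D : ColoredGraph (Label k))

/-- `r` is the root of the in-tree of color `i` that contains `u`. -/
def RootAt (i : Fin k) (u r : D.V) : Prop :=
  D.HasColor (.treeRoot i) r ∧ ReflTransGen (D.ColorAdj (.treeEdge i)) u r

/-- `r` is the root of an in-tree that contains `u` and has its color in `C`. -/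
def Guided (C : Finset (Fin k)) (u r : D.V) : Prop := ∃ i, i ∈ C ∧ D.RootAt i u r

/-- There is a link with anchor `m` and other endpoint `a`. -/
def Linked (m a : D.V) : Prop :=
  (D.ColorAdj (.link true) m a ∧ D.HasColor .side m ∧ ¬ D.HasColor .side a) ∨
    (D.ColorAdj (.link false) m a ∧ ¬ D.HasColor .side m ∧ D.HasColor .side a)

/-- No set that is encoded as an adhesion with anchor `m` separates `a` from `v`. -/
def Region (m a v : D.V) : Prop :=
  ∀ (C : Finset (Fin k)) (j : Fin k) (u : D.V), D.HasColor (.guide C j) u → D.RootAt j u m →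
    ReflTransGen (fun p q => D.G.Adj p q ∧ ¬ D.Guided C u q) a v

/-- `v` is in the smallest encoded component that contains `x`. -/
def Component (x v : D.V) : Prop :=
  ReflTransGen D.G.Adj x v ∧ ∀ m a, D.Linked m a → D.Region m a x → D.Region m a v

/-- The representatives of the nodes. -/
def IsNode (x : D.V) : Prop := D.HasColor .rep x

/-- `y` represents the parent of the node represented by `x`. -/
def Parent (x y : D.V) : Prop :=
  D.IsNode x ∧ D.IsNode y ∧ x ≠ y ∧ D.Component y x ∧
    ∀ z, D.IsNode z → z ≠ x → D.Component z x → D.Component z y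

/-- `v` is in the bag of the node represented by `x`. -/
def InBag (v x : D.V) : Prop :=
  D.IsNode x ∧ (D.Component x v ∨ ∃ w, D.Component x w ∧ D.G.Adj v w) ∧
    ∀ y, D.IsNode y → y ≠ x → D.Component x y → ¬ D.Component y v

/-- `v` is in the adhesion of the node represented by `x`. -/
def InAdhesion (v x : D.V) : Prop := D.InBag v x ∧ ∃ y, D.Parent x y ∧ D.InBag v y

/-- `v` is in the cone of the node represented by `x`. -/
def InCone (v x : D.V) : Prop := ∃ y, ReflTransGen D.Parent y x ∧ D.InBag v y

/-- `x` and `y` are neighbors in the forest of nodes. -/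
def Near (x y : D.V) : Prop := D.Parent x y ∨ D.Parent y x

/-- The encoded relations form a tree decomposition. -/
def IsTreeDecomposition : Prop :=
  (∀ x y z, D.Parent x y → D.Parent x z → y = z) ∧
  (∀ x y, D.Parent x y → ¬ ReflTransGen D.Parent y x) ∧
  (∀ v, (∃ x, D.InBag v x) ∧ ∀ x y, D.InBag v x → D.InBag v y →
    ReflTransGen (fun p q => D.Near p q ∧ D.InBag v q) x y) ∧
  ∀ u v, D.G.Adj u v → ∃ x, D.InBag u x ∧ D.InBag v x

/-- The encoded tree decomposition is sane. -/
def IsSane : Prop :=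
  ∀ x, D.IsNode x →
    (∃ v, D.InBag v x ∧ ¬ D.InAdhesion v x) ∧
    (∀ u v, D.InCone u x → D.InCone v x →
      ReflTransGen (fun p q => D.G.Adj p q ∧ D.InCone q x) u v) ∧
    (∀ u v, D.InCone u x ∧ ¬ D.InAdhesion u x → D.InCone v x ∧ ¬ D.InAdhesion v x →
      ReflTransGen (fun p q => D.G.Adj p q ∧ D.InCone q x ∧ ¬ D.InAdhesion q x) u v) ∧
    ∀ v, D.InAdhesion v x → ∃ u, (D.InCone u x ∧ ¬ D.InAdhesion u x) ∧ D.G.Adj v u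

/-- The encoded in-trees of the same color are disjoint, and they capture the adhesions. -/
def IsCaptured : Prop :=
  (∀ i r s, D.HasColor (.treeRoot i) r → D.RootAt i r s → r = s) ∧
  ∀ x, D.IsNode x → ∃ u, ∀ v, D.InAdhesion v x → ∃ i, D.RootAt i u v

end ColoredGraph

namespace VDef

open ColoredGraph

variable {n : ℕ}

theorem rootAt (i : Fin k) (a b : Fin n) : VDef fun D x => D.RootAt i (x a) (x b) :=
  (hasColor _ _).and (reflTransGen (colorAdj _ _ _) _ _)

theorem guided (C : Finset (Fin k)) (a b : Fin n) : VDef fun D x => D.Guided C (x a) (x b) :=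
  ex_finite fun i => (const _).and (rootAt i a b)

theorem linked (a b : Fin n) : VDef fun (D : ColoredGraph (Label k)) x => D.Linked (x a) (x b) :=
  ((colorAdj _ _ _).and ((hasColor _ _).and (hasColor _ _).not)).or
    ((colorAdj _ _ _).and ((hasColor _ _).not.and (hasColor _ _)))

theorem region (a b c : Fin n) :
    VDef fun (D : ColoredGraph (Label k)) x => D.Region (x a) (x b) (x c) :=
  all_finite fun C => all_finite fun j => all <| (hasColor _ _).imp <|
    (rootAt j (Fin.last n) a.castSucc).imp <| reflTransGen (i := b.castSucc) (j := c.castSucc)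
      ((adj _ _).and (guided C (Fin.last n).castSucc.castSucc (Fin.last _)).not)

theorem component (a b : Fin n) :
    VDef fun (D : ColoredGraph (Label k)) x => D.Component (x a) (x b) :=
  (reflTransGen (adj _ _) _ _).and <| all <| all <|
    (linked (Fin.last n).castSucc (Fin.last _)).imp <|
      (region (Fin.last n).castSucc (Fin.last _) a.castSucc.castSucc).imp
        (region (Fin.last n).castSucc (Fin.last _) b.castSucc.castSucc)

theorem isNode (a : Fin n) : VDef fun (D : ColoredGraph (Label k)) x => D.IsNode (x a) :=
  hasColor _ _

theorem parent (a b : Fin n) : VDef fun (D : ColoredGraph (Label k)) x => D.Parent (x a) (x b) :=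
  (isNode a).and <| (isNode b).and <| (eq a b).not.and <| (component b a).and <| all <|
    (isNode (Fin.last n)).imp <| (eq (Fin.last n) a.castSucc).not.imp <|
      (component (Fin.last n) a.castSucc).imp (component (Fin.last n) b.castSucc)

theorem inBag (a b : Fin n) : VDef fun (D : ColoredGraph (Label k)) x => D.InBag (x a) (x b) :=
  (isNode b).and <| ((component b a).or <| ex <|
      (component b.castSucc (Fin.last n)).and (adj a.castSucc (Fin.last n))).and <| all <|
    (isNode (Fin.last n)).imp <| (eq (Fin.last n) b.castSucc).not.imp <|
      (component b.castSucc (Fin.last n)).imp (component (Fin.last n) a.castSucc).not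

theorem inAdhesion (a b : Fin n) :
    VDef fun (D : ColoredGraph (Label k)) x => D.InAdhesion (x a) (x b) :=
  (inBag a b).and <| ex <| (parent b.castSucc (Fin.last n)).and (inBag a.castSucc (Fin.last n))

theorem inCone (a b : Fin n) : VDef fun (D : ColoredGraph (Label k)) x => D.InCone (x a) (x b) :=
  ex <| (reflTransGen (i := Fin.last n) (j := b.castSucc) (parent _ _)).and
    (inBag a.castSucc (Fin.last n))

theorem isTreeDecomposition :
    VDef fun (D : ColoredGraph (Label k)) (_ : Fin 0 → D.V) => D.IsTreeDecomposition :=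
  (all <| all <| all <| (parent 0 1).imp <| (parent 0 2).imp (eq 1 2)).and <|
    (all <| all <| (parent 0 1).imp (reflTransGen (i := 1) (j := 0) (parent _ _)).not).and <|
    (all <| (ex (inBag 0 1)).and <| all <| all <| (inBag 0 1).imp <| (inBag 0 2).imp <|
      reflTransGen (i := 1) (j := 2) (((parent 3 4).or (parent 4 3)).and (inBag 0 4))).and <|
    all <| all <| (adj 0 1).imp <| ex <| (inBag 0 2).and (inBag 1 2)

theorem isSane : VDef fun (D : ColoredGraph (Label k)) (_ : Fin 0 → D.V) => D.IsSane :=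
  all <| (isNode 0).imp <|
    (ex <| (inBag 1 0).and (inAdhesion 1 0).not).and <|
    (all <| all <| (inCone 1 0).imp <| (inCone 2 0).imp <|
      reflTransGen (i := 1) (j := 2) ((adj 3 4).and (inCone 4 0))).and <|
    (all <| all <| ((inCone 1 0).and (inAdhesion 1 0).not).imp <|
      ((inCone 2 0).and (inAdhesion 2 0).not).imp <| reflTransGen (i := 1) (j := 2)
        ((adj 3 4).and ((inCone 4 0).and (inAdhesion 4 0).not))).and <|
    all <| (inAdhesion 1 0).imp <| ex <| ((inCone 2 0).and (inAdhesion 2 0).not).and (adj 1 2)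

theorem isCaptured : VDef fun (D : ColoredGraph (Label k)) (_ : Fin 0 → D.V) => D.IsCaptured :=
  (all_finite fun i => all <| all <| (hasColor _ 0).imp <| (rootAt i 0 1).imp (eq 0 1)).and <|
    all <| (isNode 0).imp <| ex <| all <| (inAdhesion 2 0).imp <| ex_finite fun i => rootAt i 1 2

end VDef

/-! ### The transduction -/

namespace MSOFormula

variable {L : FirstOrder.Language.{0, 0}} {n m : ℕ}

/-- The conjunction of two formulas. -/
def conj (φ ψ : MSOFormula L n m) : MSOFormula L n m := (φ.imp ψ.neg).neg

theorem realize_conj {M : Type} [L.Structure M] (φ ψ : MSOFormula L n m) (x : Fin n → M)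
    (Y : Fin m → Set M) : (φ.conj ψ).Realize x Y ↔ φ.Realize x Y ∧ ψ.Realize x Y := by
  simp only [conj, realize_neg, Realize]
  tauto

end MSOFormula

/-- A definable relation between vertices is expressed by a formula that holds for vertices
only. -/
theorem VDef.exists_formula {κ : Type} [Finite κ] {n : ℕ}
    {P : ∀ D : ColoredGraph κ, (Fin n → D.V) → Prop} (hP : VDef P) :
    ∃ φ : MSOFormula (coloredLanguage κ) n 0, ∀ (D : ColoredGraph κ) (x : Fin n → D.Elem),
      φ.Realize x Fin.elim0 ↔ ∃ y : Fin n → D.V, (∀ i, x i = .inl (y i)) ∧ P D y := by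
  obtain ⟨φ, hφ⟩ := hP 0
  have key : ∀ l : List (Fin n), ∃ ψ : MSOFormula (coloredLanguage κ) n 0,
      ∀ (D : ColoredGraph κ) (x : Fin n → D.Elem), ψ.Realize x Fin.elim0 ↔
        (∀ i ∈ l, ∃ v, x i = .inl v) ∧ φ.Realize x Fin.elim0 := fun l => by
    induction l with
    | nil => exact ⟨φ, fun D x => by simp⟩
    | cons i l ih =>
      obtain ⟨ψ, hψ⟩ := ih
      refine ⟨(MSOFormula.isVertex i).conj ψ, fun D x => ?_⟩
      rw [MSOFormula.realize_conj, MSOFormula.realize_isVertex, hψ, List.forall_mem_cons, and_assoc]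
  obtain ⟨ψ, hψ⟩ := key (List.finRange n)
  refine ⟨ψ, fun D x => (hψ D x).trans ⟨fun ⟨h, hx⟩ => ?_, fun ⟨y, hy, hP⟩ => ?_⟩⟩
  · choose y hy using fun i => h i (List.mem_finRange i)
    obtain rfl : x = fun i => .inl (y i) := funext hy
    exact ⟨y, hy, (hφ D y _).1 hx⟩
  · obtain rfl : x = fun i => .inl (y i) := funext hy
    exact ⟨fun i _ => ⟨y i, rfl⟩, (hφ D y _).2 hP⟩

/-- The universe of the decoded structure consists of the vertices and edges; every node is
identified with its representative. -/
theorem exists_decoding (k : ℕ) :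
    ∃ I : Interpretation (coloredLanguage (Label k)) treeDecompositionLanguage,
      ∀ D : ColoredGraph (Label k),
        (I.dom.Realize (M := D.Elem) Fin.elim0 Fin.elim0 ↔
          (D.IsTreeDecomposition ∧ D.IsSane) ∧ D.IsCaptured) ∧
        (∀ a : D.Elem, I.univ.Realize (fun _ => a) Fin.elim0) ∧
        (∀ x : Fin 2 → D.Elem, (I.rel TreeDecompositionRel.incident).Realize x Fin.elim0 ↔
          ∃ (v : D.V) (e : D.G.edgeSet), x 0 = .inl v ∧ x 1 = .inr e ∧ v ∈ (e : Sym2 D.V)) ∧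
        (∀ x : Fin 1 → D.Elem, (I.rel TreeDecompositionRel.node).Realize x Fin.elim0 ↔
          ∃ v, x 0 = .inl v ∧ D.IsNode v) ∧
        (∀ x : Fin 2 → D.Elem, (I.rel TreeDecompositionRel.parent).Realize x Fin.elim0 ↔
          ∃ v w, x 0 = .inl v ∧ x 1 = .inl w ∧ D.Parent v w) ∧
        ∀ x : Fin 2 → D.Elem, (I.rel TreeDecompositionRel.bag).Realize x Fin.elim0 ↔
          ∃ v w, x 0 = .inl v ∧ x 1 = .inl w ∧ D.InBag v w := by
  obtain ⟨dom, hdom⟩ := ((VDef.isTreeDecomposition (k := k)).and .isSane).and .isCaptured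
    |>.exists_formula
  obtain ⟨node, hnode⟩ := (VDef.isNode (k := k) (0 : Fin 1)).exists_formula
  obtain ⟨parent, hparent⟩ := (VDef.parent (k := k) (0 : Fin 2) 1).exists_formula
  obtain ⟨bag, hbag⟩ := (VDef.inBag (k := k) (0 : Fin 2) 1).exists_formula
  refine ⟨⟨dom, MSOFormula.falsum.neg, fun {n} R => match n, R with
    | _, .incident => .incident 0 1
    | _, .node => node
    | _, .parent => parent
    | _, .bag => bag⟩, fun D => ⟨?_, fun _ => id, fun _ => Iff.rfl, fun x => ?_, fun x => ?_,
      fun x => ?_⟩⟩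
  · refine (hdom D _).trans ⟨fun ⟨_, _, h⟩ => h, fun h => ⟨Fin.elim0, fun i => i.elim0, h⟩⟩
  · refine (hnode D x).trans ⟨fun ⟨y, h, hy⟩ => ⟨y 0, h 0, hy⟩, fun ⟨v, h, hv⟩ =>
      ⟨![v], fun i => ?_, hv⟩⟩
    rw [Subsingleton.elim i 0]
    exact h
  · refine (hparent D x).trans ⟨fun ⟨y, h, hy⟩ => ⟨y 0, y 1, h 0, h 1, hy⟩,
      fun ⟨v, w, hv, hw, h⟩ => ⟨![v, w], Fin.forall_fin_two.2 ⟨hv, hw⟩, h⟩⟩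
  · refine (hbag D x).trans ⟨fun ⟨y, h, hy⟩ => ⟨y 0, y 1, h 0, h 1, hy⟩,
      fun ⟨v, w, hv, hw, h⟩ => ⟨![v, w], Fin.forall_fin_two.2 ⟨hv, hw⟩, h⟩⟩

/-- The vocabulary of two copies of a tree decomposition whose nodes are vertices. -/
abbrev copiedLanguage : FirstOrder.Language.{0, 0} := treeDecompositionLanguage.sum (copyLanguage 2)

/-- The universe of two copies of a structure. -/
abbrev Copied (A : FinStr treeDecompositionLanguage) : Type := Fin 2 × A.carrier

instance (A : FinStr treeDecompositionLanguage) : copiedLanguage.Structure (Copied A) :=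
  (copyStr 2 A).str

namespace MSOFormula

variable {n m : ℕ}

/-- The predicate selecting a layer. -/
def layer (l : Fin 2) (i : Fin n) : MSOFormula copiedLanguage n m :=
  rel (.inr (CopyRel.layer l) : copiedLanguage.Relations 1) ![i]

/-- The predicate relating the copies of an element. -/
def copy (i j : Fin n) : MSOFormula copiedLanguage n m :=
  rel (.inr CopyRel.copy : copiedLanguage.Relations 2) ![i, j]

/-- A binary relation of the copied structure. -/
def rel₂ (R : TreeDecompositionRel 2) (i j : Fin n) : MSOFormula copiedLanguage n m :=
  rel (.inl R : copiedLanguage.Relations 2) ![i, j]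

/-- The predicate selecting the copies of the nodes. -/
def node (i : Fin n) : MSOFormula copiedLanguage n m :=
  rel (.inl TreeDecompositionRel.node : copiedLanguage.Relations 1) ![i]

variable {A : FinStr treeDecompositionLanguage} (x : Fin n → Copied A)
  (Y : Fin m → Set (Copied A))

theorem realize_layer (l : Fin 2) (i : Fin n) : (layer l i).Realize x Y ↔ (x i).1 = l := Iff.rfl

theorem realize_copy (i j : Fin n) : (copy i j).Realize x Y ↔ (x i).2 = (x j).2 := Iff.rfl

theorem realize_rel₂ (R : TreeDecompositionRel 2) (i j : Fin n) : (rel₂ R i j).Realize x Y ↔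
    (x i).1 = (x j).1 ∧
      RelMap (L := treeDecompositionLanguage) (M := A.carrier) R ![(x i).2, (x j).2] := by
  refine and_congr ⟨fun ⟨l, h⟩ => (h 0).trans (h 1).symm,
    fun h => ⟨_, Fin.forall_fin_two.2 ⟨h, rfl⟩⟩⟩ (iff_of_eq (congrArg _ ?_))
  exact funext (Fin.forall_fin_two.2 ⟨rfl, rfl⟩)

theorem realize_node (i : Fin n) : (node i).Realize x Y ↔
    RelMap (L := treeDecompositionLanguage) (M := A.carrier) TreeDecompositionRel.node
      ![(x i).2] := by
  refine (and_iff_right ⟨(x i).1, fun j => ?_⟩).trans (iff_of_eq (congrArg _ (funext fun j => ?_)))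
    <;> rw [Subsingleton.elim j 0] <;> rfl

end MSOFormula

open MSOFormula in
/-- Separates the nodes from their representatives: the vertices and edges are taken from the first
layer, and the nodes from the second. -/
def splitting : Interpretation copiedLanguage treeDecompositionLanguage where
  dom := falsum.neg
  univ := (layer 0 0).neg.imp ((layer 1 0).conj (node 0))
  rel := fun {n} R => match n, R with
    | _, .incident => (layer 0 0).conj (rel₂ .incident 0 1)
    | _, .node => layer 1 0
    | _, .parent => (layer 1 0).conj (rel₂ .parent 0 1)
    | _, .bag => (layer 0 0).conj
        ((layer 1 1).conj (allElem ((copy 2 1).imp (rel₂ .bag 0 2).neg)).neg)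

section Splitting

open MSOFormula

variable {A : FinStr treeDecompositionLanguage}

theorem splitting_univ (p : Copied A) :
    splitting.univ.Realize (M := Copied A) (fun _ => p) Fin.elim0 ↔
      p.1 = 0 ∨ p.1 = 1 ∧
        RelMap (L := treeDecompositionLanguage) (M := A.carrier) TreeDecompositionRel.node
          ![p.2] := by
  simp only [splitting, Realize, realize_neg, realize_conj, realize_layer, realize_node,
    or_iff_not_imp_left]

theorem splitting_incident (p : Fin 2 → Copied A) :
    (splitting.rel TreeDecompositionRel.incident).Realize (M := Copied A) p Fin.elim0 ↔
      (p 0).1 = 0 ∧ (p 0).1 = (p 1).1 ∧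
        RelMap (L := treeDecompositionLanguage) (M := A.carrier) TreeDecompositionRel.incident
          ![(p 0).2, (p 1).2] := by
  simp only [splitting, realize_conj, realize_layer, realize_rel₂]

theorem splitting_node (p : Fin 1 → Copied A) :
    (splitting.rel TreeDecompositionRel.node).Realize (M := Copied A) p Fin.elim0 ↔
      (p 0).1 = 1 := by
  simp only [splitting, realize_layer]

theorem splitting_parent (p : Fin 2 → Copied A) :
    (splitting.rel TreeDecompositionRel.parent).Realize (M := Copied A) p Fin.elim0 ↔
      (p 0).1 = 1 ∧ (p 0).1 = (p 1).1 ∧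
        RelMap (L := treeDecompositionLanguage) (M := A.carrier) TreeDecompositionRel.parent
          ![(p 0).2, (p 1).2] := by
  simp only [splitting, realize_conj, realize_layer, realize_rel₂]

theorem splitting_bag (p : Fin 2 → Copied A) :
    (splitting.rel TreeDecompositionRel.bag).Realize (M := Copied A) p Fin.elim0 ↔
      (p 0).1 = 0 ∧ (p 1).1 = 1 ∧
        RelMap (L := treeDecompositionLanguage) (M := A.carrier) TreeDecompositionRel.bag
          ![(p 0).2, (p 1).2] := by
  simp only [splitting, realize_conj, realize_layer, realize_neg, Realize, realize_rel₂,
    realize_copy]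
  refine and_congr_right fun _ => and_congr_right fun _ => ⟨fun h => ?_, fun h h' => ?_⟩
  · by_contra h'
    refine h fun a ha hb => h' ?_
    have h₂ : a.2 = (p 1).2 := ha
    rw [← h₂]
    exact hb.2
  · exact h' ((p 0).1, (p 1).2) rfl ⟨rfl, h⟩

theorem splitting_iso {V N : Type} [Finite V] [Finite N]
    {G : SimpleGraph V} (t : TreeDecomposition G N) (f : V ⊕ G.edgeSet ≃ A.carrier) (s : N → V)
    (hs : Function.Injective s)
    (hincident : ∀ a b, RelMap (L := treeDecompositionLanguage) TreeDecompositionRel.incident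
      ![f a, f b] ↔ ∃ (v : V) (e : G.edgeSet), a = .inl v ∧ b = .inr e ∧ v ∈ (e : Sym2 V))
    (hnode : ∀ a, RelMap (L := treeDecompositionLanguage) TreeDecompositionRel.node ![f a] ↔
      ∃ x, a = .inl (s x))
    (hparent : ∀ x y, RelMap (L := treeDecompositionLanguage) TreeDecompositionRel.parent
      ![f (.inl (s x)), f (.inl (s y))] ↔ t.parent x = some y)
    (hbag : ∀ a x, RelMap (L := treeDecompositionLanguage) TreeDecompositionRel.bag
      ![f a, f (.inl (s x))] ↔ ∃ v, a = .inl v ∧ v ∈ t.bag x) :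
    (splitting.outStr (copyStr 2 A)).Iso t.toStr := by
  have huniv : ∀ p : Copied A,
      splitting.univ.Realize (M := Copied A) (fun _ => p) Fin.elim0 ↔
      p.1 = 0 ∨ p.1 = 1 ∧ ∃ x, p.2 = f (.inl (s x)) := fun p => by
    refine (splitting_univ p).trans (or_congr_right (and_congr_right fun _ => ?_))
    obtain ⟨a, ha⟩ := f.surjective p.2
    rw [← ha, hnode]
    simp only [f.injective.eq_iff]
  let g : (V ⊕ G.edgeSet) ⊕ N → Copied A :=
    Sum.elim (fun a => (0, f a)) fun x => (1, f (.inl (s x)))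
  have hg : ∀ a, splitting.univ.Realize (M := Copied A) (fun _ => g a) Fin.elim0 := by
    rintro (a | x)
    exacts [(huniv _).2 (.inl rfl), (huniv _).2 (.inr ⟨rfl, x, rfl⟩)]
  let g' : t.toStr.carrier → (splitting.outStr (copyStr 2 A)).carrier := fun a => ⟨g a, hg a⟩
  have hg' : Function.Bijective g' := by
    constructor
    · have hinj : Function.Injective g := by
        rintro (a | x) (b | y) h
        · exact congrArg _ (f.injective (congrArg Prod.snd h))
        · exact absurd (congrArg Prod.fst h) zero_ne_one
        · exact absurd (congrArg Prod.fst h) one_ne_zero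
        · exact congrArg _ (hs (Sum.inl_injective (f.injective (congrArg Prod.snd h))))
      exact fun a b h => hinj (congrArg Subtype.val h)
    · rintro ⟨⟨l, b⟩, hb⟩
      rcases (huniv _).1 hb with h | ⟨h, x, hx⟩
      · obtain ⟨a, rfl⟩ := f.surjective b
        exact ⟨.inl a, Subtype.ext (Prod.ext h.symm rfl)⟩
      · exact ⟨.inr x, Subtype.ext (Prod.ext h.symm hx.symm)⟩
  refine .symm (.of_equiv (A := t.toStr) (Equiv.ofBijective g' hg') fun {n} R p => ?_)
  obtain ⟨q, rfl⟩ : ∃ q : Fin n → (V ⊕ G.edgeSet) ⊕ N, q = p := ⟨p, rfl⟩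
  cases R with
  | incident =>
    refine (splitting_incident fun j => g (q j)).trans (Iff.trans ?_ (show _ ↔
      ∃ (v : V) (e : G.edgeSet), q 0 = .inl (.inl v) ∧ q 1 = .inl (.inr e) ∧ v ∈ (e : Sym2 V)
      from Iff.rfl))
    rcases q 0 with a | x <;> rcases q 1 with b | y <;> simp [g, hincident]
  | node =>
    refine (splitting_node fun j => g (q j)).trans (Iff.trans ?_ (show _ ↔
      ∃ x : N, q 0 = .inr x from Iff.rfl))
    rcases q 0 with a | x <;> simp [g]
  | parent =>
    refine (splitting_parent fun j => g (q j)).trans (Iff.trans ?_ (show _ ↔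
      ∃ x y : N, q 0 = .inr x ∧ q 1 = .inr y ∧ t.parent x = some y from Iff.rfl))
    rcases q 0 with a | x <;> rcases q 1 with b | y <;> simp [g, hparent]
  | bag =>
    refine (splitting_bag fun j => g (q j)).trans (Iff.trans ?_ (show _ ↔
      ∃ (v : V) (x : N), q 0 = .inl (.inl v) ∧ q 1 = .inr x ∧ v ∈ t.bag x from Iff.rfl))
    rcases q 0 with a | x <;> rcases q 1 with b | y <;> simp [g, hbag]

end Splitting

/-! ### Colorings that represent tree decompositions -/

theorem connected_induce_iff {V : Type} {G : SimpleGraph V} {A : Set V} :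
    (G.induce A).Connected ↔ A.Nonempty ∧
      ∀ u v, u ∈ A → v ∈ A → ReflTransGen (fun p q => G.Adj p q ∧ q ∈ A) u v := by
  rw [SimpleGraph.connected_iff, and_comm, Set.nonempty_coe_sort]
  refine and_congr_right fun _ => ⟨fun h u v hu hv => ?_, fun h u v => ?_⟩
  · exact ((SimpleGraph.reachable_iff_reflTransGen _ _).1 (h ⟨u, hu⟩ ⟨v, hv⟩)).lift
      Subtype.val fun p q hpq => ⟨hpq, q.2⟩
  · have key : ∀ w, ReflTransGen (fun p q => G.Adj p q ∧ q ∈ A) u w →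
        ∃ hw : w ∈ A, (G.induce A).Reachable u ⟨w, hw⟩ := fun w hw => by
      induction hw with
      | refl => exact ⟨u.2, .rfl⟩
      | tail _ hpq ih =>
        obtain ⟨hp, ih⟩ := ih
        exact ⟨hpq.2, ih.trans (SimpleGraph.Adj.reachable hpq.1)⟩
    exact (key v (h u v u.2 v.2)).2

variable {k : ℕ}

namespace ColoredGraph

/-- The coloring of `D` represents the tree decomposition `t` when the nodes are represented by the
vertices given by `s`. -/
structure Represents (D : ColoredGraph (Label k)) {N : Type} (t : TreeDecomposition D.G N)
    (s : N → D.V) : Prop where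
  injective : Function.Injective s
  isNode : ∀ v, D.IsNode v ↔ ∃ x, s x = v
  parent : ∀ x y, D.Parent (s x) (s y) ↔ t.parent x = some y
  inBag : ∀ v x, D.InBag v (s x) ↔ v ∈ t.bag x

namespace Represents

variable {D : ColoredGraph (Label k)} {N : Type} {t : TreeDecomposition D.G N} {s : N → D.V}

theorem exists_of_parent (h : D.Represents t s) {a b : D.V} (hab : D.Parent a b) :
    ∃ x y, s x = a ∧ s y = b ∧ t.parent x = some y := by
  obtain ⟨x, rfl⟩ := (h.isNode a).1 hab.1
  obtain ⟨y, rfl⟩ := (h.isNode b).1 hab.2.1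
  exact ⟨x, y, rfl, rfl, (h.parent x y).1 hab⟩

theorem exists_of_inBag (h : D.Represents t s) {v a : D.V} (hv : D.InBag v a) :
    ∃ x, s x = a ∧ v ∈ t.bag x := by
  obtain ⟨x, rfl⟩ := (h.isNode a).1 hv.1
  exact ⟨x, rfl, (h.inBag v x).1 hv⟩

theorem ancestor (h : D.Represents t s) (x y : N) :
    ReflTransGen D.Parent (s x) (s y) ↔ ReflTransGen (fun z w => t.parent z = some w) x y := by
  refine ⟨fun hxy => ?_, fun hxy => hxy.lift s fun z w => (h.parent z w).2⟩
  have key : ∀ b, ReflTransGen D.Parent (s x) b →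
      ∃ y, s y = b ∧ ReflTransGen (fun z w => t.parent z = some w) x y := fun b hb => by
    induction hb with
    | refl => exact ⟨x, rfl, .refl⟩
    | tail _ hbc ih =>
      obtain ⟨y, rfl, hy⟩ := ih
      obtain ⟨y', z, hy', rfl, hz⟩ := h.exists_of_parent hbc
      cases h.injective hy'
      exact ⟨z, rfl, hy.tail hz⟩
  obtain ⟨y', hy', hxy'⟩ := key _ hxy
  cases h.injective hy'
  exact hxy'

theorem inAdhesion (h : D.Represents t s) (v : D.V) (x : N) :
    D.InAdhesion v (s x) ↔ v ∈ t.adhesion x := by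
  refine and_congr (h.inBag v x) ⟨?_, ?_⟩
  · rintro ⟨b, hb, hv⟩
    obtain ⟨y, rfl, hy⟩ := h.exists_of_inBag hv
    exact ⟨y, (h.parent x y).1 hb, hy⟩
  · rintro ⟨y, hy, hv⟩
    exact ⟨s y, (h.parent x y).2 hy, (h.inBag v y).2 hv⟩

theorem inCone (h : D.Represents t s) (v : D.V) (x : N) :
    D.InCone v (s x) ↔ v ∈ t.cone x := by
  constructor
  · rintro ⟨b, hb, hv⟩
    obtain ⟨y, rfl, hy⟩ := h.exists_of_inBag hv
    exact ⟨y, (h.ancestor y x).1 hb, hy⟩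
  · rintro ⟨y, hy, hv⟩
    exact ⟨s y, (h.ancestor y x).2 hy, (h.inBag v y).2 hv⟩

theorem isTreeDecomposition (h : D.Represents t s) : D.IsTreeDecomposition := by
  refine ⟨fun a b c hab hac => ?_, fun a b hab hba => ?_, fun v => ⟨?_, fun a b ha hb => ?_⟩,
    fun u v huv => ?_⟩
  · obtain ⟨x, y, rfl, rfl, hy⟩ := h.exists_of_parent hab
    obtain ⟨x', z, hx, rfl, hz⟩ := h.exists_of_parent hac
    cases h.injective hx
    exact congrArg s (Option.some_injective _ (hy.symm.trans hz))
  · obtain ⟨x, y, rfl, rfl, hy⟩ := h.exists_of_parent hab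
    exact t.acyclic x (.head' hy ((h.ancestor y x).1 hba))
  · obtain ⟨⟨x, hx⟩⟩ := (t.connected v).nonempty
    exact ⟨s x, (h.inBag v x).2 hx⟩
  · obtain ⟨x, rfl, hx⟩ := h.exists_of_inBag ha
    obtain ⟨y, rfl, hy⟩ := h.exists_of_inBag hb
    refine ((connected_induce_iff.1 (t.connected v)).2 x y hx hy).lift s
      fun z w hzw => ⟨?_, (h.inBag v w).2 hzw.2⟩
    exact ((SimpleGraph.fromRel_adj _ _ _).1 hzw.1).2.imp (h.parent z w).2 (h.parent w z).2
  · obtain ⟨x, hu, hv⟩ := t.edge_covered u v huv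
    exact ⟨s x, (h.inBag u x).2 hu, (h.inBag v x).2 hv⟩

theorem isSane_iff (h : D.Represents t s) : D.IsSane ↔ t.IsSane := by
  have hcone := fun x => connected_induce_iff (G := D.G) (A := t.cone x)
  have hcomp := fun x => connected_induce_iff (G := D.G) (A := t.component x)
  have key : D.IsSane ↔ ∀ x,
      (∃ v, v ∈ t.margin x) ∧
      (∀ u v, u ∈ t.cone x → v ∈ t.cone x →
        ReflTransGen (fun p q => D.G.Adj p q ∧ q ∈ t.cone x) u v) ∧
      (∀ u v, u ∈ t.component x → v ∈ t.component x →
        ReflTransGen (fun p q => D.G.Adj p q ∧ q ∈ t.component x) u v) ∧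
      ∀ v ∈ t.adhesion x, ∃ u ∈ t.component x, D.G.Adj v u := by
    constructor
    · intro hD x
      have := hD (s x) ((h.isNode _).2 ⟨x, rfl⟩)
      simp only [h.inBag, h.inAdhesion, h.inCone] at this
      exact this
    · intro ht a ha
      obtain ⟨x, rfl⟩ := (h.isNode a).1 ha
      simp only [h.inBag, h.inAdhesion, h.inCone]
      exact ht x
  have hne : ∀ x, (t.margin x).Nonempty → (t.component x).Nonempty :=
    fun x ⟨v, hv⟩ => ⟨v, ⟨x, .refl, hv.1⟩, hv.2⟩
  rw [key]
  constructor
  · intro ht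
    exact ⟨fun x => (ht x).1,
      fun x => (hcone x).2 ⟨(hne x (ht x).1).mono Set.sdiff_subset, (ht x).2.1⟩,
      fun x => (hcomp x).2 ⟨hne x (ht x).1, (ht x).2.2.1⟩, fun x => (ht x).2.2.2⟩
  · intro ht x
    exact ⟨ht.margin_nonempty x, ((hcone x).1 (ht.cone_connected x)).2,
      ((hcomp x).1 (ht.component_connected x)).2, ht.adhesion_neighbor x⟩

end Represents

open Classical in
/-- The nodes of the decoded tree decomposition are their own representatives. -/
theorem IsTreeDecomposition.exists_represents {D : ColoredGraph (Label k)}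
    (h : D.IsTreeDecomposition) :
    ∃ t : TreeDecomposition D.G {x // D.IsNode x}, D.Represents t Subtype.val := by
  obtain ⟨hfun, hacyc, hconn, hcov⟩ := h
  let par : {x // D.IsNode x} → Option {x // D.IsNode x} := fun x =>
    if h : ∃ y : {x // D.IsNode x}, D.Parent x y then some h.choose else none
  have hpar : ∀ x y, par x = some y ↔ D.Parent x.1 y.1 := fun x y => by
    by_cases h : ∃ y : {x // D.IsNode x}, D.Parent x y
    · simp only [par, dif_pos h, Option.some.injEq]
      exact ⟨fun hy => hy ▸ h.choose_spec, fun hy => Subtype.ext (hfun _ _ _ h.choose_spec hy)⟩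
    · simp only [par, dif_neg h, reduceCtorEq, false_iff]
      exact fun hy => h ⟨y, hy⟩
  refine ⟨{
    parent := par
    acyclic := fun x hx => ?_
    bag := fun x => {v | D.InBag v x}
    connected := fun v => ?_
    edge_covered := fun u v huv => ?_ }, Subtype.val_injective, fun v => ?_, fun x y => ?_,
      fun v x => Iff.rfl⟩
  · obtain ⟨y, hxy, hyx⟩ := TransGen.head'_iff.1 hx
    exact hacyc _ _ ((hpar x y).1 hxy) (hyx.lift Subtype.val fun z w => (hpar z w).1)
  · obtain ⟨⟨x, hx⟩, hv⟩ := hconn v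
    refine connected_induce_iff.2 ⟨⟨⟨x, hx.1⟩, hx⟩, fun y z hy hz => ?_⟩
    -- Walks in the forest of representatives lift to the subtype.
    have key : ∀ a, ReflTransGen (fun p q => D.Near p q ∧ D.InBag v q) y a →
        ∃ ha : D.IsNode a, ReflTransGen (fun p q : {x // D.IsNode x} =>
          (SimpleGraph.fromRel fun y z => par y = some z).Adj p q ∧
            q ∈ {x : {x // D.IsNode x} | D.InBag v x})
          y ⟨a, ha⟩ := fun a ha => by
      induction ha with
      | refl => exact ⟨y.2, .refl⟩
      | tail _ hbc ih =>
        obtain ⟨hb, ih⟩ := ih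
        refine ⟨hbc.2.1, ih.tail ⟨(SimpleGraph.fromRel_adj _ _ _).2 ⟨?_, ?_⟩, hbc.2⟩⟩
        · rintro h
          cases congrArg Subtype.val h
          exact hbc.1.elim (fun h => hacyc _ _ h .refl) fun h => hacyc _ _ h .refl
        · exact hbc.1.imp (hpar _ _).2 (hpar _ _).2
    exact (key z (hv y z hy hz)).2
  · obtain ⟨x, hu, hv⟩ := hcov u v huv
    exact ⟨⟨x, hu.1⟩, hu, hv⟩
  · exact ⟨fun hv => ⟨⟨v, hv⟩, rfl⟩, fun ⟨x, hx⟩ => hx ▸ x.2⟩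
  · exact (hpar x y).symm

end ColoredGraph

/-! ### Guidance systems from colorings -/

/-- A spanning tree of the component of `r` in a subgraph `H` is an in-tree with root `r`. -/
theorem exists_inTree_reachable {V : Type} [Finite V] {G H : SimpleGraph V} (hH : H ≤ G) (r : V) :
    ∃ s : InTree G, s.root = r ∧ ∀ v, v ∈ s.tree.verts ↔ H.Reachable r v := by
  have hconn : (H.induce {v | H.Reachable r v}).Connected :=
    connected_induce_iff.2 ⟨⟨r, .rfl⟩, fun u v hu hv => by
      have huv := (SimpleGraph.reachable_iff_reflTransGen u v).1 (hu.symm.trans hv)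
      induction huv with
      | refl => exact .refl
      | tail huw hwx ih =>
        have hw := hu.trans ((SimpleGraph.reachable_iff_reflTransGen u _).2 huw)
        exact (ih hw).tail ⟨hwx, hw.trans hwx.reachable⟩⟩
  obtain ⟨T, hT, htree⟩ := hconn.exists_isTree_le
  let T' : G.Subgraph :=
    { verts := {v | H.Reachable r v}
      Adj := fun v w => ∃ hv hw, T.Adj ⟨v, hv⟩ ⟨w, hw⟩
      adj_sub := fun ⟨_, _, h⟩ => hH (hT h)
      edge_vert := fun ⟨hv, _, _⟩ => hv
      symm := ⟨fun _ _ ⟨hv, hw, h⟩ => ⟨hw, hv, h.symm⟩⟩ }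
  have hT' : T'.coe = T := by
    ext v w
    exact ⟨fun ⟨_, _, h⟩ => h, fun h => ⟨v.2, w.2, h⟩⟩
  exact ⟨⟨T', hT' ▸ htree, r, .rfl⟩, rfl, fun v => Iff.rfl⟩

namespace ColoredGraph

variable {k : ℕ} {D : ColoredGraph (Label k)}

/-- The graph formed by the edges of color `c`. -/
def colorGraph {κ : Type} (D : ColoredGraph κ) (c : κ) : SimpleGraph D.V where
  Adj := D.ColorAdj c
  symm := ⟨fun v w ⟨h, hc⟩ => ⟨h.symm, by
    have he : (⟨s(w, v), h.symm⟩ : D.G.edgeSet) = ⟨s(v, w), h⟩ := Subtype.ext Sym2.eq_swap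
    exact he ▸ hc⟩⟩
  loopless := ⟨fun _ ⟨h, _⟩ => h.ne rfl⟩

/-- As the roots of each color lie in different components of the edges of that color, spanning
trees of these components form a guidance system. -/
theorem IsCaptured.exists_guidanceSystem (h : D.IsCaptured) {N : Type}
    {t : TreeDecomposition D.G N} {s : N → D.V} (ht : D.Represents t s) :
    ∃ Λ : GuidanceSystem D.G,
      GuidanceSystem.Colorable Λ k ∧ GuidanceSystem.Captures Λ t.adhesions := by
  have hle : ∀ i, D.colorGraph (.treeEdge i) ≤ D.G := fun i v w ⟨h, _⟩ => h
  choose τ hroot hverts using fun (i : Fin k) r => exists_inTree_reachable (hle i) r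
  refine ⟨{T | ∃ i r, D.HasColor (.treeRoot i) r ∧ T = τ i r}, ?_, ?_⟩
  · choose c hc using fun T : {T | ∃ i r, D.HasColor (.treeRoot i) r ∧ T = τ i r} => T.2
    refine ⟨c, fun T T' hne hcol => Set.disjoint_left.2 fun v hv hv' => hne (Subtype.ext ?_)⟩
    obtain ⟨r, hr, hT⟩ := hc T
    obtain ⟨r', hr', hT'⟩ := hc T'
    rw [hT, hverts] at hv
    rw [hT', hverts, ← hcol] at hv'
    have : r = r' := h.1 (c T) r r' hr ⟨hcol ▸ hr', (SimpleGraph.reachable_iff_reflTransGen r r').1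
      (hv.trans hv'.symm)⟩
    rw [hT, hT', this, hcol]
  · rintro _ ⟨x, rfl⟩
    obtain ⟨u, hu⟩ := h.2 (s x) ((ht.isNode _).2 ⟨x, rfl⟩)
    refine ⟨u, fun v hv => ?_⟩
    obtain ⟨i, hi, huv⟩ := hu v ((ht.inAdhesion v x).2 hv)
    refine ⟨τ i v, ⟨i, v, hi, rfl⟩, (hverts i v u).2 ?_, hroot i v⟩
    exact ((SimpleGraph.reachable_iff_reflTransGen (G := D.colorGraph (.treeEdge i)) u v).2
      huv).symm

end ColoredGraph

/-! ### Tree decompositions -/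

namespace TreeDecomposition

variable {V N : Type} {G : SimpleGraph V} (t : TreeDecomposition G N)

/-- `x` is a descendant of `y`, possibly `y` itself. -/
def Below (x y : N) : Prop := ReflTransGen (fun z w => t.parent z = some w) x y

variable {t} {x y z p : N} {u v : V}

theorem Below.refl (x : N) : t.Below x x := ReflTransGen.refl

theorem Below.trans (h : t.Below x y) (h' : t.Below y z) : t.Below x z := ReflTransGen.trans h h'

theorem below_parent (h : t.parent x = some p) : t.Below x p := ReflTransGen.single h

theorem not_below_of_parent (h : t.parent x = some p) : ¬ t.Below p x :=
  fun h' => t.acyclic x (.head' h h')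

theorem Below.eq_or_parent (h : t.Below x y) : x = y ∨ ∃ p, t.parent x = some p ∧ t.Below p y :=
  (ReflTransGen.cases_head_iff.1 h)

theorem Below.of_ne (h : t.Below x y) (hne : x ≠ y) (hp : t.parent x = some p) : t.Below p y := by
  obtain rfl | ⟨q, hq, hqy⟩ := h.eq_or_parent
  · exact absurd rfl hne
  · cases hp.symm.trans hq
    exact hqy

theorem Below.antisymm (h : t.Below x y) (h' : t.Below y x) : x = y := by
  obtain rfl | ⟨p, hp, hpy⟩ := h.eq_or_parent
  · rfl
  · exact absurd (hpy.trans h') (not_below_of_parent hp)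

theorem Below.total (h : t.Below x y) (h' : t.Below x z) : t.Below y z ∨ t.Below z y :=
  ReflTransGen.total_of_right_unique
    (fun _ _ _ ha hb => Option.some_injective _ (ha.symm.trans hb)) h h'

/-- A node whose margin contains `v` is above all nodes whose bags contain `v`: a path through such
nodes cannot leave its descendants, as the bag of its parent does not contain `v`. -/
theorem below_of_mem_margin (hv : v ∈ t.margin y) (hx : v ∈ t.bag x) : t.Below x y := by
  have h := (connected_induce_iff.1 (t.connected v)).2 y x hv.1 hx
  induction h with
  | refl => exact .refl y
  | @tail w w' hyw hww' ih =>
    have hw : v ∈ t.bag w := by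
      rcases ReflTransGen.cases_tail_iff _ _ _ |>.1 hyw with rfl | ⟨_, _, h⟩
      exacts [hv.1, h.2]
    have ih := ih hw
    rcases ((SimpleGraph.fromRel_adj _ _ _).1 hww'.1).2 with h | h
    · refine ih.of_ne ?_ h
      rintro rfl
      exact hv.2 ⟨hv.1, w', h, hx⟩
    · exact (below_parent h).trans ih

theorem exists_mem_margin [Finite N] (t : TreeDecomposition G N) (v : V) : ∃ x, v ∈ t.margin x := by
  let r : N → N → Prop := fun x y => TransGen (fun z w => t.parent z = some w) y x
  have : Std.Irrefl r := ⟨t.acyclic⟩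
  have : IsTrans N r := ⟨fun _ _ _ h h' => h'.trans h⟩
  have hwf : WellFounded r := Finite.wellFounded_of_trans_of_irrefl r
  obtain ⟨⟨x, hx⟩⟩ := (t.connected v).nonempty
  -- A topmost node whose bag contains `v` cannot have `v` in its adhesion.
  obtain ⟨y, hy, hmax⟩ := hwf.has_min {x | v ∈ t.bag x} ⟨x, hx⟩
  exact ⟨y, hy, fun ⟨_, z, hz, hvz⟩ => hmax z hvz (.single hz)⟩

theorem reachable_of_mem_component (ht : t.IsSane) {X : V → Prop}
    (hX : ∀ w ∈ t.component x, ¬ X w) (hu : u ∈ t.component x) (hv : v ∈ t.component x) :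
    ReflTransGen (fun p q => G.Adj p q ∧ ¬ X q) u v :=
  ((connected_induce_iff.1 (ht.component_connected x)).2 u v hu hv).lift id
    fun _ _ h => ⟨h.1, hX _ h.2⟩

variable [Finite N]

/-- The topmost node whose bag contains `v`. -/
noncomputable def home (t : TreeDecomposition G N) (v : V) : N := (t.exists_mem_margin v).choose

theorem mem_margin_iff : v ∈ t.margin x ↔ t.home v = x := by
  have hv : v ∈ t.margin (t.home v) := (t.exists_mem_margin v).choose_spec
  refine ⟨fun h => ?_, fun h => h ▸ hv⟩
  exact (below_of_mem_margin h hv.1).antisymm (below_of_mem_margin hv h.1)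

theorem mem_bag_home (t : TreeDecomposition G N) (v : V) : v ∈ t.bag (t.home v) :=
  (mem_margin_iff.2 rfl).1

theorem below_home (h : v ∈ t.bag x) : t.Below x (t.home v) :=
  below_of_mem_margin (mem_margin_iff.2 rfl) h

theorem mem_adhesion_iff : v ∈ t.adhesion x ↔ v ∈ t.bag x ∧ t.home v ≠ x := by
  rw [Ne, ← mem_margin_iff, margin, Set.mem_sdiff, not_and, not_not]
  exact ⟨fun h => ⟨h.1, fun _ => h⟩, fun h => h.2 h.1⟩

theorem mem_bag_of_below (hv : v ∈ t.bag x) (hxy : t.Below x y) (hy : t.Below y (t.home v)) :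
    v ∈ t.bag y := by
  induction hxy using ReflTransGen.head_induction_on with
  | refl => exact hv
  | @head x p hp hpy ih =>
    have hne : t.home v ≠ x := by
      rintro rfl
      exact not_below_of_parent hp (Below.trans hpy hy)
    obtain ⟨_, q, hq, hvq⟩ := mem_adhesion_iff.2 ⟨hv, hne⟩
    cases hp.symm.trans hq
    exact ih hvq

theorem mem_component_iff : v ∈ t.component x ↔ t.Below (t.home v) x := by
  constructor
  · rintro ⟨⟨y, hyx, hvy⟩, hx⟩
    have hyx : t.Below y x := hyx
    rcases hyx.total (below_home hvy) with h | h
    · have := mt (fun h' => mem_adhesion_iff.2 ⟨mem_bag_of_below hvy hyx h, h'⟩) hx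
      rw [not_not.1 this]
      exact .refl x
    · exact h
  · refine fun h => ⟨⟨_, h, mem_bag_home t v⟩, fun h' => ?_⟩
    rw [mem_adhesion_iff] at h'
    exact h'.2 (h.antisymm (below_home h'.1))

theorem component_mono (h : t.Below x y) : t.component x ⊆ t.component y :=
  fun _ hv => mem_component_iff.2 ((mem_component_iff.1 hv).trans h)

theorem margin_subset_component : t.margin x ⊆ t.component x :=
  fun _ hv => mem_component_iff.2 (mem_margin_iff.1 hv ▸ .refl _)

/-- The bag of `x` consists of its adhesion and of the vertices of its component that are in the
component of no proper descendant. -/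
theorem mem_bag_iff : v ∈ t.bag x ↔ v ∈ t.adhesion x ∨ v ∈ t.component x ∧
    ∀ y, y ≠ x → t.Below y x → v ∉ t.component y := by
  simp only [mem_component_iff]
  constructor
  · intro hv
    by_cases h : t.home v = x
    · subst h
      exact .inr ⟨.refl _, fun y hne hy h => hne (hy.antisymm h)⟩
    · exact .inl (mem_adhesion_iff.2 ⟨hv, h⟩)
  · rintro (h | ⟨h, h'⟩)
    · exact h.1
    · by_cases hx : t.home v = x
      · exact hx ▸ mem_bag_home t v
      · exact absurd (.refl _) (h' _ hx h)

theorem mem_adhesion_of_adj (hu : u ∈ t.component x) (hv : v ∉ t.component x) (h : G.Adj u v) :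
    v ∈ t.adhesion x := by
  obtain ⟨y, huy, hvy⟩ := t.edge_covered u v h
  by_contra hvx
  exact hv ⟨⟨y, (below_home huy).trans (mem_component_iff.1 hu), hvy⟩, hvx⟩

theorem mem_adhesion_iff_of_sane (ht : t.IsSane) :
    v ∈ t.adhesion x ↔ v ∉ t.component x ∧ ∃ u ∈ t.component x, G.Adj v u :=
  ⟨fun h => ⟨fun h' => h'.2 h, ht.adhesion_neighbor x v h⟩,
    fun ⟨hv, _, hu, h⟩ => mem_adhesion_of_adj hu hv h.symm⟩

/-- A component is closed under walks that avoid the adhesion. -/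
theorem mem_component_of_reachable
    (h : ReflTransGen (fun p q => G.Adj p q ∧ q ∉ t.adhesion x) u v) (hu : u ∈ t.component x) :
    v ∈ t.component x := by
  induction h with
  | refl => exact hu
  | tail _ h ih =>
    by_contra hv
    exact h.2 (mem_adhesion_of_adj ih hv h.1)

/-- The adhesion of a node meets the margin of the parent `p`, since otherwise the component of the
node would be separated from the margin of `p` within the component of `p`. -/
theorem exists_link (ht : t.IsSane) (hp : t.parent z = some p) :
    ∃ m ∈ t.adhesion z, t.home m = p ∧ ∃ a ∈ t.component z, G.Adj m a := by
  have key : ∃ m ∈ t.adhesion z, t.home m = p := by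
    by_contra! h
    obtain ⟨v, hv⟩ := ht.margin_nonempty z
    obtain ⟨w, hw⟩ := ht.margin_nonempty p
    have hvz := margin_subset_component hv
    have hvw := (connected_induce_iff.1 (ht.component_connected p)).2 v w
      (component_mono (below_parent hp) hvz) (margin_subset_component hw)
    have hwz : w ∈ t.component z := by
      refine mem_component_of_reachable 
        (hvw.lift id fun a b hab => ⟨hab.1, fun hb => h b hb ?_⟩) hvz
      obtain ⟨_, q, hq, hbq⟩ := hb
      cases hp.symm.trans hq
      exact (mem_component_iff.1 hab.2).antisymm (below_home hbq)
    rw [mem_component_iff, mem_margin_iff.1 hw] at hwz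
    exact not_below_of_parent hp hwz
  obtain ⟨m, hm, hmp⟩ := key
  exact ⟨m, hm, hmp, ht.adhesion_neighbor z m hm⟩

/-- The adhesion of a node does not meet the components of its siblings. -/
theorem disjoint_adhesion_component (hy : t.parent y = some p) (hz : t.parent z = some p)
    (hv : v ∈ t.component z) : v ∉ t.adhesion y := by
  rintro ⟨_, q, hq, hvq⟩
  cases hy.symm.trans hq
  exact not_below_of_parent hz ((below_home hvq).trans (mem_component_iff.1 hv))

/-- The number of descendants of a node. -/
noncomputable def rank (t : TreeDecomposition G N) (x : N) : ℕ := Set.ncard {y | t.Below y x}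

theorem Below.eq_or_rank_lt (h : t.Below x y) : x = y ∨ t.rank x < t.rank y := by
  refine or_iff_not_imp_left.2 fun hne => Set.ncard_lt_ncard ⟨fun z hz => Below.trans hz h,
    fun hs => hne (h.antisymm (hs (Below.refl y)))⟩

/-- If every node other than a root is linked from the margin of the parent to the component of the
node, then the links form a bipartite graph. In the induction on the number of descendants, a
bipartition is adjusted to further links by swapping the sides within the components of their
nodes; this affects both endpoints of an earlier link or none. -/
theorem exists_bipartition (m a : N → V)
    (hm : ∀ z p, t.parent z = some p → t.home (m z) = p)
    (ha : ∀ z p, t.parent z = some p → a z ∈ t.component z) :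
    ∃ S : Set V, ∀ z p, t.parent z = some p → (m z ∈ S ↔ a z ∉ S) := by
  have key : ∀ n, ∃ S : Set V, ∀ z p, t.parent z = some p → t.rank z < n →
      (m z ∈ S ↔ a z ∉ S) := fun n => by
    induction n with
    | zero => exact ⟨∅, fun z p _ h => absurd h (Nat.not_lt_zero _)⟩
    | succ n ih =>
      obtain ⟨S, hS⟩ := ih
      -- `F` is the union of the components in which the sides have to be swapped.
      let F : Set V := {v | ∃ z, t.rank z = n ∧ t.Below (t.home v) z ∧ (m z ∈ S ↔ a z ∈ S)}
      refine ⟨{v | ¬ (v ∈ S ↔ v ∈ F)}, fun w p hp hw => ?_⟩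
      have haw := mem_component_iff.1 (ha w p hp)
      have hwp : t.rank w < t.rank p := (below_parent hp).eq_or_rank_lt.resolve_left
        fun h => not_below_of_parent hp (h ▸ .refl _)
      rcases Nat.lt_succ_iff_lt_or_eq.1 hw with hlt | rfl
      · have hF : m w ∈ F ↔ a w ∈ F := by
          refine exists_congr fun z => and_congr_right fun hz => and_congr_left fun _ => ?_
          rw [hm w p hp]
          refine ⟨fun h => haw.trans ((below_parent hp).trans h), fun h => ?_⟩
          rcases haw.total h with h' | h'
          · refine h'.of_ne ?_ hp
            rintro rfl
            exact absurd hz hlt.ne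
          · rcases h'.eq_or_rank_lt with rfl | h'
            · exact absurd hz hlt.ne
            · exact absurd (hz ▸ h') hlt.not_gt
        have := hS w p hp hlt
        simp only [Set.mem_ofPred_eq]
        tauto
      · have hmF : m w ∉ F := by
          rintro ⟨z, hz, hpz, _⟩
          rw [hm w p hp] at hpz
          rcases hpz.eq_or_rank_lt with rfl | h
          · exact hwp.ne' hz
          · exact absurd (hwp.trans h) hz.not_gt
        have haF : a w ∈ F ↔ (m w ∈ S ↔ a w ∈ S) := by
          refine ⟨fun ⟨z, hz, haz, h⟩ => ?_, fun h => ⟨w, rfl, haw, h⟩⟩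
          have : w = z := by
            rcases haw.total haz with h' | h'
            · exact h'.eq_or_rank_lt.resolve_right (by omega)
            · exact (h'.eq_or_rank_lt.resolve_right (by omega)).symm
          exact this ▸ h
        simp only [Set.mem_ofPred_eq]
        tauto
  obtain ⟨n, hn⟩ := (Set.finite_range t.rank).bddAbove
  obtain ⟨S, hS⟩ := key (n + 1)
  exact ⟨S, fun z p hp => hS z p hp (Nat.lt_succ_of_le (hn ⟨z, rfl⟩))⟩

end TreeDecomposition

/-! ### Encoding a captured sane tree decomposition -/

/-- The choices by which a sane tree decomposition `t` and a `k`-colored guidance system `Λ` that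
captures its adhesions are encoded in a coloring of the graph. -/
structure Encoding {V N : Type} {G : SimpleGraph V} [Finite N] (t : TreeDecomposition G N)
    (Λ : GuidanceSystem G) (k : ℕ) where
  treeColor : {T // T ∈ Λ} → Fin k
  disjoint : ∀ T T', T ≠ T' → treeColor T = treeColor T' → Disjoint T.1.tree.verts T'.1.tree.verts
  /-- A vertex from the margin of each node. -/
  rep : N → V
  home_rep : ∀ x, t.home (rep x) = x
  /-- A vertex from which the adhesion of each node is captured. -/
  source : N → V
  adhesion_subset : ∀ x, t.adhesion x ⊆ Λ.reach (source x)
  /-- For each node other than a root, a vertex of its adhesion from the margin of its parent. -/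
  anchor : N → V
  /-- A neighbor of the anchor in the component of the node. -/
  target : N → V
  anchor_mem : ∀ z p, t.parent z = some p → anchor z ∈ t.adhesion z
  home_anchor : ∀ z p, t.parent z = some p → t.home (anchor z) = p
  target_mem : ∀ z p, t.parent z = some p → target z ∈ t.component z
  adj : ∀ z p, t.parent z = some p → G.Adj (anchor z) (target z)
  /-- One side of a bipartition of the links. -/
  side : Set V
  anchor_mem_side_iff : ∀ z p, t.parent z = some p → (anchor z ∈ side ↔ target z ∉ side)

namespace Encoding

variable {V N : Type} {G : SimpleGraph V} [Finite N] {t : TreeDecomposition G N}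
  {Λ : GuidanceSystem G} {k : ℕ}

theorem nonempty (ht : t.IsSane) (hk : GuidanceSystem.Colorable Λ k)
    (hΛ : GuidanceSystem.Captures Λ t.adhesions) : Nonempty (Encoding t Λ k) := by
  obtain ⟨c, hc⟩ := hk
  choose s hs using ht.margin_nonempty
  choose u hu using fun x => hΛ (t.adhesion x) ⟨x, rfl⟩
  have hlink : ∀ z, ∃ m a, ∀ p, t.parent z = some p →
      m ∈ t.adhesion z ∧ t.home m = p ∧ a ∈ t.component z ∧ G.Adj m a := fun z => by
    cases hz : t.parent z with
    -- A root has no link, so any vertices will do.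
    | none => exact ⟨s z, s z, fun p hp => by simp at hp⟩
    | some p =>
      obtain ⟨m, hm, hmp, a, ha, hma⟩ := t.exists_link ht hz
      exact ⟨m, a, fun q hq => ⟨hm, hmp.trans (Option.some_injective _ hq), ha, hma⟩⟩
  choose m a hma using hlink
  obtain ⟨S, hS⟩ := t.exists_bipartition m a (fun z p hp => (hma z p hp).2.1)
    fun z p hp => (hma z p hp).2.2.1
  exact ⟨{
    treeColor := c
    disjoint := hc
    rep := s
    home_rep := fun x => TreeDecomposition.mem_margin_iff.1 (hs x)
    source := u
    adhesion_subset := hu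
    anchor := m
    target := a
    anchor_mem := fun z p hp => (hma z p hp).1
    home_anchor := fun z p hp => (hma z p hp).2.1
    target_mem := fun z p hp => (hma z p hp).2.2.1
    adj := fun z p hp => (hma z p hp).2.2.2
    side := S
    anchor_mem_side_iff := hS }⟩

variable (E : Encoding t Λ k)

/-- The in-tree `T` has color `i`, contains `u`, and has root `r`. -/
def HasRoot (i : Fin k) (u r : V) : Prop :=
  ∃ T, E.treeColor T = i ∧ u ∈ T.1.tree.verts ∧ T.1.root = r

theorem HasRoot.unique {E : Encoding t Λ k} {i : Fin k} {u r r' : V} (h : E.HasRoot i u r)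
    (h' : E.HasRoot i u r') : r = r' := by
  obtain ⟨T, hT, hu, rfl⟩ := h
  obtain ⟨T', hT', hu', rfl⟩ := h'
  by_cases hne : T = T'
  · rw [hne]
  · exact absurd hu' (Set.disjoint_left.1 (E.disjoint T T' hne (hT.trans hT'.symm)) hu)

theorem rep_injective : Function.Injective E.rep :=
  fun x y h => by rw [← E.home_rep x, h, E.home_rep]

theorem exists_hasRoot {x : N} {v : V} (hv : v ∈ t.adhesion x) :
    ∃ i, E.HasRoot i (E.source x) v := by
  obtain ⟨T, hT, hu, hr⟩ := E.adhesion_subset x hv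
  exact ⟨_, ⟨T, hT⟩, rfl, hu, hr⟩

open Classical in
/-- The colors of the in-trees by which the adhesion of `x` is captured. -/
noncomputable def colors (x : N) : Finset (Fin k) :=
  {i | ∃ r ∈ t.adhesion x, E.HasRoot i (E.source x) r}

/-- The coloring of the graph by which the tree decomposition is encoded. -/
noncomputable def coloring : Label k → Set (V ⊕ G.edgeSet)
  | .treeEdge i => {b | ∃ T, E.treeColor T = i ∧ ∃ e : G.edgeSet, e.1 ∈ T.1.tree.edgeSet ∧
      b = .inr e}
  | .treeRoot i => {b | ∃ T, E.treeColor T = i ∧ b = .inl T.1.root}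
  | .guide C j => {b | ∃ z p, t.parent z = some p ∧ E.colors z = C ∧
      E.HasRoot j (E.source z) (E.anchor z) ∧ b = .inl (E.source z)}
  | .rep => {b | ∃ x, b = .inl (E.rep x)}
  | .side => {b | ∃ v ∈ E.side, b = .inl v}
  | .link c => {b | ∃ z p, t.parent z = some p ∧ (E.anchor z ∈ E.side ↔ c = true) ∧
      ∃ e : G.edgeSet, e.1 = s(E.anchor z, E.target z) ∧ b = .inr e}

variable [Finite V]

/-- The graph with the coloring by which the tree decomposition is encoded. -/
noncomputable abbrev graph : ColoredGraph (Label k) := ⟨V, G, E.coloring⟩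

theorem colorAdj_treeEdge (i : Fin k) (u v : V) :
    E.graph.ColorAdj (.treeEdge i) u v ↔ ∃ T, E.treeColor T = i ∧ T.1.tree.Adj u v := by
  constructor
  · rintro ⟨h, T, hT, e, he, hb⟩
    cases hb
    exact ⟨T, hT, he⟩
  · rintro ⟨T, hT, h⟩
    exact ⟨T.1.tree.adj_sub h, T, hT, ⟨s(u, v), T.1.tree.adj_sub h⟩, h, rfl⟩

theorem reachable_of_mem_verts {T : {T // T ∈ Λ}} {u v : V} (hu : u ∈ T.1.tree.verts)
    (hv : v ∈ T.1.tree.verts) :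
    ReflTransGen (E.graph.ColorAdj (.treeEdge (E.treeColor T))) u v :=
  ((SimpleGraph.reachable_iff_reflTransGen _ _).1
    (T.1.isTree.connected ⟨u, hu⟩ ⟨v, hv⟩)).lift Subtype.val
    fun _ _ h => (E.colorAdj_treeEdge _ _ _).2 ⟨T, rfl, h⟩

/-- As in-trees of the same color are disjoint, a walk along edges of their color does not leave an
in-tree. -/
theorem mem_verts_of_reachable {T : {T // T ∈ Λ}} {u v : V} (hv : v ∈ T.1.tree.verts)
    (h : ReflTransGen (E.graph.ColorAdj (.treeEdge (E.treeColor T))) u v) :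
    u ∈ T.1.tree.verts := by
  induction h using ReflTransGen.head_induction_on with
  | refl => exact hv
  | @head p q hpq _ ih =>
    obtain ⟨T', hT', h⟩ := (E.colorAdj_treeEdge _ _ _).1 hpq
    by_cases hne : T' = T
    · exact hne ▸ h.fst_mem
    · exact absurd ih (Set.disjoint_left.1 (E.disjoint T' T hne hT') h.snd_mem)

theorem rootAt_iff (i : Fin k) (u r : V) : E.graph.RootAt i u r ↔ E.HasRoot i u r := by
  constructor
  · rintro ⟨⟨T, rfl, hr⟩, h⟩
    cases Sum.inl_injective hr
    exact ⟨T, rfl, E.mem_verts_of_reachable T.1.root_mem h, rfl⟩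
  · rintro ⟨T, rfl, hu, rfl⟩
    exact ⟨⟨T, rfl, rfl⟩, E.reachable_of_mem_verts hu T.1.root_mem⟩

theorem guided_iff (x : N) (v : V) :
    E.graph.Guided (E.colors x) (E.source x) v ↔ v ∈ t.adhesion x := by
  simp only [ColoredGraph.Guided, rootAt_iff, colors, Finset.mem_filter, Finset.mem_univ, true_and]
  constructor
  · rintro ⟨i, ⟨r, hr, hir⟩, hiv⟩
    exact hiv.unique hir ▸ hr
  · intro hv
    obtain ⟨i, hi⟩ := E.exists_hasRoot hv
    exact ⟨i, ⟨v, hv, hi⟩, hi⟩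

theorem hasColor_side (v : V) : E.graph.HasColor .side v ↔ v ∈ E.side :=
  ⟨fun ⟨_, hw, h⟩ => Sum.inl_injective h ▸ hw, fun h => ⟨v, h, rfl⟩⟩

theorem colorAdj_link (c : Bool) (u v : V) : E.graph.ColorAdj (.link c) u v ↔
    ∃ z p, t.parent z = some p ∧ (E.anchor z ∈ E.side ↔ c = true) ∧
      s(u, v) = s(E.anchor z, E.target z) := by
  constructor
  · rintro ⟨h, z, p, hp, hs, e, he, hb⟩
    cases hb
    exact ⟨z, p, hp, hs, he⟩
  · rintro ⟨z, p, hp, hs, he⟩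
    have h : G.Adj u v := by
      rw [← SimpleGraph.mem_edgeSet, he]
      exact E.adj z p hp
    exact ⟨h, z, p, hp, hs, _, he, rfl⟩

theorem linked_iff (u v : V) : E.graph.Linked u v ↔
    ∃ z p, t.parent z = some p ∧ u = E.anchor z ∧ v = E.target z := by
  simp only [ColoredGraph.Linked, colorAdj_link, hasColor_side, Sym2.eq_iff]
  constructor
  · rintro (⟨⟨z, p, hp, hs, ⟨rfl, rfl⟩ | ⟨rfl, rfl⟩⟩, hu, hv⟩ |
      ⟨⟨z, p, hp, hs, ⟨rfl, rfl⟩ | ⟨rfl, rfl⟩⟩, hu, hv⟩)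
    · exact ⟨z, p, hp, rfl, rfl⟩
    · simp_all
    · exact ⟨z, p, hp, rfl, rfl⟩
    · simp_all
  · rintro ⟨z, p, hp, rfl, rfl⟩
    have h := E.anchor_mem_side_iff z p hp
    by_cases hs : E.anchor z ∈ E.side
    · exact .inl ⟨⟨z, p, hp, by simp [hs], .inl ⟨rfl, rfl⟩⟩, hs, h.1 hs⟩
    · exact .inr ⟨⟨z, p, hp, by simp [hs], .inl ⟨rfl, rfl⟩⟩, hs, not_not.1 (mt h.2 hs)⟩

/-- The nodes with the same anchor as `z` are siblings of `z`, so none of the sets that are encoded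
as their adhesions meets the component of `z`, while the adhesion of `z` separates it from the
remaining graph. -/
theorem region_iff (ht : t.IsSane) {z p : N} (hp : t.parent z = some p) (v : V) :
    E.graph.Region (E.anchor z) (E.target z) v ↔ v ∈ t.component z := by
  constructor
  · intro h
    obtain ⟨j, hj⟩ := E.exists_hasRoot (E.anchor_mem z p hp)
    have := h (E.colors z) j (E.source z) ⟨z, p, hp, rfl, hj, rfl⟩ ((E.rootAt_iff _ _ _).2 hj)
    simp only [guided_iff] at this
    exact TreeDecomposition.mem_component_of_reachable this (E.target_mem z p hp)
  · rintro hv C j u ⟨y, q, hq, rfl, hj, hu⟩ hroot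
    cases Sum.inl_injective hu
    have h := ((E.rootAt_iff _ _ _).1 hroot).unique hj
    have hpq : p = q := by rw [← E.home_anchor z p hp, h, E.home_anchor y q hq]
    subst hpq
    exact TreeDecomposition.reachable_of_mem_component ht
      (fun w hw => (E.guided_iff y w).not.2
        (TreeDecomposition.disjoint_adhesion_component hq hp hw)) (E.target_mem z p hp) hv

/-- For a root, the component is a connected component of the graph; for any other node, it is the
region of its own link. Every region that contains the representative of `x` belongs to an ancestor
of `x`. -/
theorem component_iff (ht : t.IsSane) (x : N) (v : V) :
    E.graph.Component (E.rep x) v ↔ v ∈ t.component x := by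
  have hrep : E.rep x ∈ t.component x := by
    rw [TreeDecomposition.mem_component_iff, E.home_rep]
    exact .refl x
  constructor
  · rintro ⟨hreach, h⟩
    cases hx : t.parent x with
    | none =>
      refine TreeDecomposition.mem_component_of_reachable
        (hreach.lift id fun _ _ h => ⟨h, ?_⟩) hrep
      rintro ⟨_, p, hp, _⟩
      simp [hx] at hp
    | some p =>
      rw [← E.region_iff ht hx]
      exact h _ _ ((E.linked_iff _ _).2 ⟨x, p, hx, rfl, rfl⟩) ((E.region_iff ht hx _).2 hrep)
  · intro hv
    refine ⟨(TreeDecomposition.reachable_of_mem_component ht (X := fun _ => False)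
      (fun _ _ => id) hrep hv).lift id fun _ _ h => h.1, fun m a hma h => ?_⟩
    obtain ⟨z, p, hp, rfl, rfl⟩ := (E.linked_iff _ _).1 hma
    rw [E.region_iff ht hp] at h ⊢
    rw [TreeDecomposition.mem_component_iff, E.home_rep] at h
    exact TreeDecomposition.component_mono h hv

theorem component_rep_iff (ht : t.IsSane) (x y : N) :
    E.graph.Component (E.rep x) (E.rep y) ↔ t.Below y x := by
  rw [E.component_iff ht, TreeDecomposition.mem_component_iff, E.home_rep]

theorem isNode_iff (v : V) : E.graph.IsNode v ↔ ∃ x, E.rep x = v :=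
  exists_congr fun _ => ⟨fun h => (Sum.inl_injective h).symm, fun h => h ▸ rfl⟩

theorem forall_isNode {P : E.graph.V → Prop} : (∀ v : E.graph.V, E.graph.IsNode v → P v) ↔
    ∀ x, P (E.rep x) := by
  simp only [isNode_iff, forall_exists_index, forall_apply_eq_imp_iff]

theorem represents (ht : t.IsSane) : E.graph.Represents t E.rep where
  injective := E.rep_injective
  isNode := E.isNode_iff
  parent x y := by
    have hx := (E.isNode_iff _).2 ⟨x, rfl⟩
    have hy := (E.isNode_iff _).2 ⟨y, rfl⟩
    refine (and_iff_right hx).trans ((and_iff_right hy).trans ((and_congr E.rep_injective.ne_iff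
      (and_congr (E.component_rep_iff ht y x) (E.forall_isNode.trans (forall_congr' fun z =>
        imp_congr E.rep_injective.ne_iff (imp_congr (E.component_rep_iff ht z x)
          (E.component_rep_iff ht z y)))))).trans ?_))
    constructor
    · rintro ⟨hne, hxy, h⟩
      obtain rfl | ⟨p, hp, hpy⟩ := hxy.eq_or_parent
      · exact absurd rfl hne
      · have hne' : p ≠ x := by
          rintro rfl
          exact TreeDecomposition.not_below_of_parent hp (.refl _)
        rw [hp, hpy.antisymm (h p hne' (TreeDecomposition.below_parent hp))]
    · intro hp
      refine ⟨?_, TreeDecomposition.below_parent hp, fun z hz hxz => hxz.of_ne hz.symm hp⟩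
      rintro rfl
      exact TreeDecomposition.not_below_of_parent hp (.refl _)
  inBag v x := by
    have hx := (E.isNode_iff _).2 ⟨x, rfl⟩
    refine (and_iff_right hx).trans ((and_congr (or_congr (E.component_iff ht x v)
      (exists_congr fun w => and_congr_left' (E.component_iff ht x w)))
        (E.forall_isNode.trans (forall_congr' fun y => imp_congr E.rep_injective.ne_iff
          (imp_congr (E.component_rep_iff ht x y) (E.component_iff ht y v).not)))).trans ?_)
    rw [TreeDecomposition.mem_bag_iff, TreeDecomposition.mem_adhesion_iff_of_sane ht]
    have h : v ∉ t.component x → ∀ y, y ≠ x → t.Below y x → v ∉ t.component y :=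
      fun hv y _ hy hvy => hv (TreeDecomposition.component_mono hy hvy)
    constructor
    · rintro ⟨hv | hw, hy⟩
      · exact .inr ⟨hv, hy⟩
      · by_cases hv : v ∈ t.component x
        exacts [.inr ⟨hv, hy⟩, .inl ⟨hv, hw⟩]
    · rintro (⟨hv, hw⟩ | ⟨hv, hy⟩)
      exacts [⟨.inr hw, h hv⟩, ⟨.inl hv, hy⟩]

theorem isCaptured (ht : t.IsSane) : E.graph.IsCaptured := by
  refine ⟨fun i r s hr hs => ?_, E.forall_isNode.2 fun x => ⟨E.source x, fun v hv => ?_⟩⟩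
  · exact ((E.rootAt_iff i r r).1 ⟨hr, .refl⟩).unique ((E.rootAt_iff i r s).1 hs)
  · simp only [rootAt_iff]
    exact E.exists_hasRoot (((E.represents ht).inAdhesion v x).1 hv)

end Encoding

/-! ### Composition -/

/-- The outputs of the transduction are the structures `out D` for the colored graphs `D` that
encode a captured sane tree decomposition. -/
theorem exists_isMSO (k : ℕ) : ∃ (T : Transduction graphLanguage treeDecompositionLanguage)
    (out : ColoredGraph (Label k) → FinStr treeDecompositionLanguage), IsMSO T ∧
      (∀ (D : ColoredGraph (Label k)) (N : Type) [Finite N] (t : TreeDecomposition D.G N)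
        (s : N → D.V), D.Represents t s → (out D).Iso t.toStr) ∧
      ∀ (V : Type) [Finite V] (G : SimpleGraph V) (B : FinStr treeDecompositionLanguage),
        T (graphStr G) B ↔ ∃ X : Label k → Set (V ⊕ G.edgeSet),
          ((ColoredGraph.mk V G X).IsTreeDecomposition ∧ (ColoredGraph.mk V G X).IsSane) ∧
            (ColoredGraph.mk V G X).IsCaptured ∧ B.Iso (out ⟨V, G, X⟩) := by
  obtain ⟨I, hI⟩ := exists_decoding k
  refine ⟨(coloring graphLanguage (Nat.card (Label k))).comp (I.transduction.comp
    ((copying treeDecompositionLanguage 2).comp splitting.transduction)),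
    fun D => splitting.outStr (copyStr 2 (I.outStr D.toStr)),
    .comp (.coloring _) (.comp (.interpretation I) (.comp (.copying 2) (.interpretation _))),
    fun D N _ t s h => ?_, fun V _ G B => ⟨?_, ?_⟩⟩
  · obtain ⟨-, huniv, hincident, hnode, hparent, hbag⟩ := hI D
    let f : D.Elem ≃ (I.outStr D.toStr).carrier := (Equiv.subtypeUnivEquiv huniv).symm
    refine splitting_iso t f s h.injective (fun a b => hincident fun j => (![f a, f b] j).1)
      (fun a => (hnode fun j => (![f a] j).1).trans ?_)
      (fun x y => (hparent fun j => (![f (.inl (s x)), f (.inl (s y))] j).1).trans ?_)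
      fun a x => (hbag fun j => (![f a, f (.inl (s x))] j).1).trans ?_
    · change (∃ v, a = .inl v ∧ D.IsNode v) ↔ _
      constructor
      · rintro ⟨v, rfl, hv⟩
        obtain ⟨x, rfl⟩ := (h.isNode v).1 hv
        exact ⟨x, rfl⟩
      · rintro ⟨x, rfl⟩
        exact ⟨_, rfl, (h.isNode _).2 ⟨x, rfl⟩⟩
    · refine Iff.trans ⟨?_, fun hxy => ⟨_, _, rfl, rfl, hxy⟩⟩ (h.parent x y)
      rintro ⟨v, w, hv, hw, hvw⟩
      exact Sum.inl_injective hv ▸ Sum.inl_injective hw ▸ hvw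
    · change (∃ v w, a = .inl v ∧ (.inl (s x) : D.Elem) = .inl w ∧ D.InBag v w) ↔ _
      constructor
      · rintro ⟨v, w, rfl, hw, hv⟩
        cases Sum.inl_injective hw
        exact ⟨v, rfl, (h.inBag v x).1 hv⟩
      · rintro ⟨v, rfl, hv⟩
        exact ⟨v, _, rfl, rfl, (h.inBag v x).2 hv⟩
  · rintro ⟨A₁, ⟨X, h₁⟩, A₂, ⟨hdom, h₂⟩, A₃, h₃, -, h₄⟩
    let X' : Label k → Set (V ⊕ G.edgeSet) := fun c => X (Finite.equivFin _ c)
    have hX : colorStr (graphStr G) X = (ColoredGraph.mk V G X').toStr := by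
      simp [X', ColoredGraph.toStr]
    rw [hX] at h₁
    obtain ⟨htd, hc⟩ := (hI ⟨V, G, X'⟩).1.1 ((I.dom_iso h₁).1 hdom)
    exact ⟨X', htd, hc, h₄.trans (splitting.outStr_iso (h₃.trans (copyStr_iso 2
      (h₂.trans (I.outStr_iso h₁)))))⟩
  · rintro ⟨X, htd, hc, hB⟩
    exact ⟨_, ⟨_, .refl _⟩, _, ⟨(hI ⟨V, G, X⟩).1.2 ⟨htd, hc⟩, .refl _⟩, _, .refl _, id, hB⟩

end MSOTransduction

theorem mainTheorem8 (k : ℕ) :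
    ∃ T : Transduction graphLanguage treeDecompositionLanguage, IsMSO T ∧
      ∀ (V : Type) [Finite V] (G : SimpleGraph V) (B : FinStr treeDecompositionLanguage),
        T (graphStr G) B ↔
          ∃ (N : Type) (_ : Finite N) (t : TreeDecomposition G N),
            t.IsSane ∧
            (∃ Λ : GuidanceSystem G,
              GuidanceSystem.Colorable Λ k ∧ GuidanceSystem.Captures Λ t.adhesions) ∧
            B.Iso t.toStr := by
  obtain ⟨T, out, hT, hout, h⟩ := exists_isMSO k
  refine ⟨T, hT, fun V _ G B => (h V G B).trans ⟨?_, ?_⟩⟩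
  · rintro ⟨X, ⟨htd, hs⟩, hc, hB⟩
    obtain ⟨t, ht⟩ := htd.exists_represents
    exact ⟨_, inferInstance, t, ht.isSane_iff.1 hs, hc.exists_guidanceSystem ht,
      hB.trans (hout _ _ t _ ht)⟩
  · rintro ⟨N, _, t, ht, ⟨Λ, hk, hΛ⟩, hB⟩
    obtain ⟨E⟩ := Encoding.nonempty ht hk hΛ
    have hE := E.represents ht
    exact ⟨E.coloring, ⟨hE.isTreeDecomposition, hE.isSane_iff.2 ht⟩, E.isCaptured ht,
      hB.trans (hout E.graph _ t _ hE).symm⟩
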